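/- **Categories.** - $\mathsf{AlgFrm}$: objects are algebraic frames, i.e. frames $L$ in which every element is a join of elements of the set $K(L)$ of compact elements; morphisms are frame homomorphisms (preserving arbitrary joins and finite meets, including the top $1$) that send compact elements to compact elements. - $\mathsf{DMS}_{\mathsf P}$: objects are distributive meet-semilattices, i.e. posets $M$ with all finite meets (in particular with a top, but not necessarily with a bottom) such that whenever $a\wedge b\le c$ there are $a'\ge a$, $b'\ge b$ with $a'\wedge b'=c$. Morphisms are the maps $\alpha:M_1\to M_2$ preserving finite meets (including the top) such that for every finite (possibly empty) $S\subseteq M_1$ and every upper bound $x$ of $\alpha[S]$ there is an upper bound $c$ of $S$ with $\alpha(c)\le x$. - $\mathsf{PGPS}_{\mathsf P}$: objects are pointed generalized Priestley spaces $\langle X,\tau,\le,X_0,m\rangle$: $\langle X,\tau,\le\rangle$ is a Priestley space (a compact ordered space in which $x\not\le y$ implies that some clopen upset contains $x$ and misses $y$); $m$ is the greatest element of $X$; $X_0\subseteq X\setminus\{m\}$ is dense in $X\setminus\{m\}$, and every $x\ne m$ lies below some $y\in X_0$; $x\in X_0$ iff $\mathcal I_x=\{U\in\mathcal A(X): x\notin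 U\}$ is nonempty and directed under inclusion; and $x\le y$ iff every $U\in\mathcal A(X)$ containing $x$ contains $y$. Here $\mathcal A(X)$ is the set of admissible clopen upsets: the clopen upsets $U$ for which all maximal elements of $X\setminus U$ lie in $X_0$. Morphisms are the strong Priestley morphisms $f:X\to Y$ (order-preserving, with $f^{-1}(U)\in\mathcal A(X)$ for all $U\in\mathcal A(Y)$) with $f[X_0]\subseteq Y_0$. **Functors.** A filter of $M$ is an upset closed under finite meets. It is prime if it is proper and $F_1\cap F_2\subseteq P$ implies $F_1\subseteq P$ or $F_2\subseteq P$ for all filters $F_1,F_2$. It is optimal if it is the restriction to $M$ of a prime filter of the distributive envelope of $M$, that is, of the lattice of finite (possibly empty) unions of the sets $\{P \text{ prime filter of } M: a\in P\}$, $a\in M$, into which $M$ is mapped by $a\mapsto\{P: a\in P\}$. An element $p\neq 1$ of $L$ is prime if $a\wedge b\le p$ implies $a\le p$ or $b\le p$; it is pseudoprime if $a_1\wedge\dots\wedge a_n\ll p$ implies $a_i\le p$ for some $i$, where $a\ll b$ means that $b\le\bigvee S$ implies $a\le\bigvee T$ for some finite $T\subseteq S$. Let $P(L)$ be the set of primes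 of $L$, and let $Y_L$ consist of the pseudoprimes of $L$ together with $1$, with the order of $L$ and the topology generated by the sets ${\uparrow}k\cap Y_L$, $k\in K(L)$, and their complements. Let $X_M$ be the set consisting of the optimal filters of $M$ and $M$ itself, ordered by inclusion, with the topology generated by the sets $\{F: a\in F\}$, $a\in M$, and their complements. A closed upset $C$ of $X$ is admissible if $X\setminus C={\downarrow}(X_0\setminus C)$. **Theorem.** 1. $\mathsf{AlgFrm}$ is equivalent to $\mathsf{DMS}_{\mathsf P}$ and dually equivalent to $\mathsf{PGPS}_{\mathsf P}$. More precisely (each functor being determined up to natural isomorphism by the description): - the functor $\mathcal F$ sending $M$ to the lattice of its filters ordered by inclusion, and $\alpha$ to $F\mapsto{\uparrow}\alpha[F]$, is an equivalence $\mathsf{DMS}_{\mathsf P}\to\mathsf{AlgFrm}$, with quasi-inverse the functor $\mathcal K$ sending $L$ to $K(L)$ with the dual order and $\alpha$ to its restriction; - the contravariant functor $\mathcal Y$ sending $L$ to $\langle Y_L, P(L), 1\rangle$ and $\alpha$ to the restriction of its right adjoint is a dual equivalence $\mathsf{AlgFrm}\to\mathsf{PGPS}_{\mathsf P}$, with quasi-inverse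 the functor $\mathcal V^a$ sending $X$ to its admissible closed upsets ordered by reverse inclusion and $f$ to $f^{-1}$; - the contravariant functor $\mathcal X$ sending $M$ to $\langle X_M,\{\text{prime filters}\},M\rangle$ and $\alpha$ to $\alpha^{-1}$ is a dual equivalence $\mathsf{DMS}_{\mathsf P}\to\mathsf{PGPS}_{\mathsf P}$, with quasi-inverse the functor $\mathcal A$ sending $X$ to $\mathcal A(X)$ ordered by inclusion and $f$ to $f^{-1}$; - $\mathcal X\cong\mathcal Y\circ\mathcal F$ and $\mathcal A\cong\mathcal K\circ\mathcal V^a$. 2. Let $L_1,L_2$ be algebraic frames, and let $\alpha:L_1\to L_2$ preserve arbitrary joins and compact elements, with right adjoint $r$. The following are equivalent: - (a) $\alpha$ is a frame homomorphism; - (b) $r(P(L_2))\subseteq P(L_1)$; - (c) $r$ restricts to a strong Priestley morphism $Y_{L_2}\to Y_{L_1}$, and $r(P(L_2))\subseteq P(L_1)$; - (d) for every finite $S\subseteq K(L_1)$ and every $k\in K(L_2)$ with $k\le\bigwedge\alpha[S]$ there is $c\in K(L_1)$ with $c\le\bigwedge S$ and $k\le\alpha(c)$. -/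

import Mathlib

open CategoryTheory Opposite OrderDual

universe u

/-! ### Algebraic frames -/

/-- An algebraic frame: a frame in which every element is a join of compact elements. -/
structure AlgFrm : Type (u + 1) where
  carrier : Type u
  [frame : Order.Frame carrier]
  [algebraic : IsCompactlyGenerated carrier]

namespace AlgFrm

instance : CoeSort AlgFrm.{u} (Type u) := ⟨AlgFrm.carrier⟩

attribute [instance] AlgFrm.frame AlgFrm.algebraic

/-- Morphisms of algebraic frames: frame homomorphisms (all joins, finite meets) that send
compact elements to compact elements. -/
@[ext]
structure Hom (L₁ L₂ : AlgFrm.{u}) : Type u where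
  toFrameHom : FrameHom L₁ L₂
  map_compact : ∀ k : L₁, IsCompactElement k → IsCompactElement (toFrameHom k)

instance : Category AlgFrm.{u} where
  Hom L₁ L₂ := Hom L₁ L₂
  id L := ⟨FrameHom.id L, fun _ hk => hk⟩
  comp f g := ⟨g.toFrameHom.comp f.toFrameHom,
    fun k hk => g.map_compact _ (f.map_compact k hk)⟩

/-- The underlying map of a morphism. -/
def fn {L₁ L₂ : AlgFrm.{u}} (f : L₁ ⟶ L₂) : L₁ → L₂ := (show Hom L₁ L₂ from f).toFrameHom

end AlgFrm

/-! ### Distributive meet-semilattices -/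

/-- A distributive meet-semilattice (with top, not necessarily with bottom). -/
structure DMSP : Type (u + 1) where
  carrier : Type u
  [semilattice : SemilatticeInf carrier]
  [top : OrderTop carrier]
  distrib : ∀ a b c : carrier, a ⊓ b ≤ c → ∃ a' b' : carrier, a ≤ a' ∧ b ≤ b' ∧ a' ⊓ b' = c

namespace DMSP

instance : CoeSort DMSP.{u} (Type u) := ⟨DMSP.carrier⟩

attribute [instance] DMSP.semilattice DMSP.top

/-- Morphisms of `DMSP`: maps preserving all finite meets such that every upper bound `x` of the
image of a finite set `S` (possibly empty) lies above the image of an upper bound of `S`. -/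
@[ext]
structure Hom (M₁ M₂ : DMSP.{u}) : Type u where
  toInfTopHom : InfTopHom M₁ M₂
  lift_upperBound : ∀ (S : Set M₁), S.Finite → ∀ x ∈ upperBounds (toInfTopHom '' S),
    ∃ c ∈ upperBounds S, toInfTopHom c ≤ x

instance : Category DMSP.{u} where
  Hom M₁ M₂ := Hom M₁ M₂
  id M := ⟨InfTopHom.id M, fun S _ x hx => ⟨x, fun s hs => hx ⟨s, hs, rfl⟩, le_rfl⟩⟩
  comp f g := ⟨g.toInfTopHom.comp f.toInfTopHom, fun S hS x hx => by
    obtain ⟨d, hd, hdx⟩ := g.lift_upperBound (f.toInfTopHom '' S) (hS.image _) x (by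
      rintro _ ⟨_, ⟨s, hs, rfl⟩, rfl⟩
      exact hx ⟨s, hs, rfl⟩)
    obtain ⟨c, hc, hcd⟩ := f.lift_upperBound S hS d hd
    exact ⟨c, hc, (OrderHomClass.mono g.toInfTopHom hcd).trans hdx⟩⟩

/-- The underlying map of a morphism. -/
def fn {M₁ M₂ : DMSP.{u}} (f : M₁ ⟶ M₂) : M₁ → M₂ := (show Hom M₁ M₂ from f).toInfTopHom

end DMSP

/-! ### Pointed generalized Priestley spaces -/

section Admissible

variable {X : Type u} [TopologicalSpace X] [PartialOrder X]

/-- Admissible clopen upsets, relative to a distinguished subset `X₀`: clopen upsets `U` such that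
all maximal elements of the complement of `U` belong to `X₀`. -/
def IsAdmissibleClopen (X₀ U : Set X) : Prop :=
  IsClopen U ∧ IsUpperSet U ∧ {x | Maximal (fun y => y ∉ U) x} ⊆ X₀

/-- Admissible closed upsets: closed upsets `C` whose complement is the downset generated by
`X₀ \ C`. -/
def IsAdmissibleClosed (X₀ C : Set X) : Prop :=
  IsClosed C ∧ IsUpperSet C ∧ Cᶜ = {x | ∃ y ∈ X₀ \ C, x ≤ y}

/-- The family of admissible clopen upsets that do not contain `x`. -/
def admissibleMissing (X₀ : Set X) (x : X) : Set (Set X) :=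
  {U | IsAdmissibleClopen X₀ U ∧ x ∉ U}

/-- Strong Priestley morphisms: order-preserving maps such that preimages of admissible clopen
upsets are admissible clopen upsets. -/
def IsStrongPriestley {Y : Type u} [TopologicalSpace Y] [PartialOrder Y]
    (X₀ : Set X) (Y₀ : Set Y) (f : X → Y) : Prop :=
  Monotone f ∧ ∀ U : Set Y, IsAdmissibleClopen Y₀ U → IsAdmissibleClopen X₀ (f ⁻¹' U)

end Admissible

/-- A pointed generalized Priestley space `⟨X, τ, ≤, X₀, m⟩`. -/
structure PGPSP : Type (u + 1) where
  carrier : Type u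
  [topology : TopologicalSpace carrier]
  [order : PartialOrder carrier]
  [compact : CompactSpace carrier]
  [priestley : PriestleySpace carrier]
  X₀ : Set carrier
  m : carrier
  le_m : ∀ x, x ≤ m
  X₀_subset : X₀ ⊆ {m}ᶜ
  X₀_dense : {m}ᶜ ⊆ closure X₀
  X₀_orderDense : ∀ x, x ≠ m → ∃ y ∈ X₀, x ≤ y
  mem_X₀_iff : ∀ x, x ∈ X₀ ↔
    (admissibleMissing X₀ x).Nonempty ∧ DirectedOn (· ⊆ ·) (admissibleMissing X₀ x)
  le_iff : ∀ x y, x ≤ y ↔ ∀ U, IsAdmissibleClopen X₀ U → x ∈ U → y ∈ U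

namespace PGPSP

instance : CoeSort PGPSP.{u} (Type u) := ⟨PGPSP.carrier⟩

attribute [instance] PGPSP.topology PGPSP.order PGPSP.compact PGPSP.priestley

/-- Morphisms of `PGPSP`: strong Priestley morphisms mapping `X₀` into `Y₀`. -/
@[ext]
structure Hom (X Y : PGPSP.{u}) : Type u where
  toFun : X → Y
  strong : IsStrongPriestley X.X₀ Y.X₀ toFun
  mapsTo : Set.MapsTo toFun X.X₀ Y.X₀

instance : Category PGPSP.{u} where
  Hom X Y := Hom X Y
  id X := ⟨fun x => x, ⟨fun _ _ h => h, fun _ hU => hU⟩, fun _ hx => hx⟩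
  comp f g := ⟨fun x => g.toFun (f.toFun x),
    ⟨fun _ _ h => g.strong.1 (f.strong.1 h), fun U hU => f.strong.2 _ (g.strong.2 U hU)⟩,
    fun _ hx => g.mapsTo (f.mapsTo hx)⟩

/-- The underlying map of a morphism. -/
def fn {X Y : PGPSP.{u}} (f : X ⟶ Y) : X → Y := (show Hom X Y from f).toFun

end PGPSP

/-! ### Prime and pseudoprime elements of a complete lattice; the space `Y_L` -/

section Pseudoprime

variable {L L' : Type u} [CompleteLattice L] [CompleteLattice L']

/-- The way below relation `a ≪ b`. -/
def WayBelow (a b : L) : Prop :=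
  ∀ S : Set L, b ≤ sSup S → ∃ T : Set L, T ⊆ S ∧ T.Finite ∧ a ≤ sSup T

/-- Pseudoprime elements: `p ≠ 1` and `a₁ ⊓ ⋯ ⊓ aₙ ≪ p` implies `aᵢ ≤ p` for some `i`.
(Prime elements are Mathlib's `InfPrime`.) -/
def IsPseudoprime (p : L) : Prop :=
  p ≠ ⊤ ∧ ∀ S : Finset L, WayBelow (S.inf id) p → ∃ a ∈ S, a ≤ p

/-- The topology on `L` with subbasis the sets `↑k` and their complements, `k` compact. -/
@[reducible]
def algebraicTopology (L : Type u) [CompleteLattice L] : TopologicalSpace L :=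
  TopologicalSpace.generateFrom
    ({U | ∃ k : L, IsCompactElement k ∧ U = Set.Ici k} ∪
      {U | ∃ k : L, IsCompactElement k ∧ U = (Set.Ici k)ᶜ})

/-- The set `Y_L` of pseudoprime elements together with the top element, ordered as in `L`. -/
abbrev YPoints (L : Type u) [CompleteLattice L] : Type u :=
  {p : L // IsPseudoprime p ∨ p = ⊤}

/-- `Y_L` carries the subspace topology. -/
instance YPoints.topology (L : Type u) [CompleteLattice L] : TopologicalSpace (YPoints L) :=
  TopologicalSpace.induced Subtype.val (algebraicTopology L)

/-- The prime elements of `L`, as a subset of `Y_L`. -/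
def YPoints.primes (L : Type u) [CompleteLattice L] : Set (YPoints L) := {p | InfPrime p.1}

/-- The right adjoint of a join-preserving map. -/
def rightAdjoint (α : L → L') (b : L') : L := sSup {a | α a ≤ b}

end Pseudoprime

/-! ### Prime and optimal filters of a meet-semilattice; the space `X_M` -/

section Filters

variable {M : Type u} [SemilatticeInf M] [OrderTop M]

/-- Prime filters: proper filters `P` such that `F₁ ∩ F₂ ⊆ P` implies `F₁ ⊆ P` or `F₂ ⊆ P`. -/
def IsPrimeFilter (P : Order.PFilter M) : Prop :=
  (P : Set M) ≠ Set.univ ∧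
    ∀ F₁ F₂ : Order.PFilter M, (F₁ : Set M) ∩ F₂ ⊆ P → F₁ ≤ P ∨ F₂ ≤ P

/-- The set of prime filters containing `a`. -/
def primeSet (a : M) : Set {P : Order.PFilter M // IsPrimeFilter P} := {P | a ∈ P.1}

set_option linter.unusedSectionVars false in
theorem primeSet_inf (a b : M) : primeSet a ∩ primeSet b = primeSet (a ⊓ b) := by
  ext P
  exact Order.PFilter.inf_mem_iff.symm

/-- The distributive envelope of a distributive meet-semilattice `M`, constructed as the lattice
of finite unions (including the empty one) of sets `primeSet a`; `M` embeds into it by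
`a ↦ primeSet a`. -/
def distributiveEnvelope (M : Type u) [SemilatticeInf M] [OrderTop M] :
    Sublattice (Set {P : Order.PFilter M // IsPrimeFilter P}) where
  carrier := {A | ∃ S : Set M, S.Finite ∧ A = ⋃ a ∈ S, primeSet a}
  supClosed' := by
    rintro _ ⟨S, hS, rfl⟩ _ ⟨T, hT, rfl⟩
    exact ⟨S ∪ T, hS.union hT, by rw [Set.biUnion_union]; rfl⟩
  infClosed' := by
    rintro _ ⟨S, hS, rfl⟩ _ ⟨T, hT, rfl⟩
    refine ⟨Set.image2 (· ⊓ ·) S T, hS.image2 _ hT, ?_⟩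
    rw [Set.biUnion_image2]
    ext P
    simp only [← primeSet_inf, Set.inf_eq_inter, Set.mem_inter_iff, Set.mem_iUnion, exists_prop]
    constructor
    · rintro ⟨⟨a, ha, hP⟩, b, hb, hQ⟩
      exact ⟨a, ha, b, hb, hP, hQ⟩
    · rintro ⟨a, ha, b, hb, hP, hQ⟩
      exact ⟨⟨a, ha, hP⟩, b, hb, hQ⟩

/-- The embedding of `M` into its distributive envelope. -/
def toEnvelope (a : M) : distributiveEnvelope M :=
  ⟨primeSet a, {a}, Set.finite_singleton a, by simp⟩

/-- Optimal filters: restrictions to `M` of prime filters of the distributive envelope. -/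
def IsOptimalFilter (F : Order.PFilter M) : Prop :=
  ∃ P : Order.PFilter (distributiveEnvelope M), P.IsPrime ∧ (F : Set M) = toEnvelope ⁻¹' P

/-- The set `X_M` of optimal filters together with the improper filter, ordered by inclusion. -/
abbrev XPoints (M : Type u) [SemilatticeInf M] [OrderTop M] : Type u :=
  {F : Order.PFilter M // IsOptimalFilter F ∨ (F : Set M) = Set.univ}

/-- The topology of `X_M`, with subbasis the sets `{F | a ∈ F}` and their complements. -/
instance XPoints.topology (M : Type u) [SemilatticeInf M] [OrderTop M] :
    TopologicalSpace (XPoints M) :=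
  TopologicalSpace.generateFrom
    ({U | ∃ a : M, U = {F : XPoints M | a ∈ F.1}} ∪
      {U | ∃ a : M, U = {F : XPoints M | a ∈ F.1}ᶜ})

end Filters

/-! ### The functors, each described up to natural isomorphism -/

/-- `F` sends `M` to its lattice of filters ordered by inclusion and `α` to `G ↦ ↑α[G]`. -/
def IsFilterFunctor (F : DMSP.{u} ⥤ AlgFrm.{u}) : Prop :=
  ∃ e : ∀ M : DMSP.{u}, Order.PFilter M ≃o F.obj M,
    ∀ (M N : DMSP.{u}) (α : M ⟶ N) (G : Order.PFilter M),
      (((e N).symm (AlgFrm.fn (F.map α) (e M G)) : Order.PFilter N) : Set N) =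
        {y | ∃ x ∈ G, DMSP.fn α x ≤ y}

/-- `K` sends `L` to its compact elements with the dual order and `α` to its restriction. -/
def IsCompactElementsFunctor (K : AlgFrm.{u} ⥤ DMSP.{u}) : Prop :=
  ∃ e : ∀ L : AlgFrm.{u}, {k : L // IsCompactElement k}ᵒᵈ ≃o K.obj L,
    ∀ (L L' : AlgFrm.{u}) (α : L ⟶ L') (k : {k : L // IsCompactElement k}),
      (ofDual ((e L').symm (DMSP.fn (K.map α) (e L (toDual k))))).1 = AlgFrm.fn α k.1

/-- `Y` sends `L` to `⟨Y_L, P(L)⟩` and `α` to the restriction of its right adjoint. -/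
def IsPseudoprimeFunctor (Y : AlgFrm.{u}ᵒᵖ ⥤ PGPSP.{u}) : Prop :=
  ∃ e : ∀ L : AlgFrm.{u}, YPoints L ≃o Y.obj (op L),
    (∀ L, IsHomeomorph (e L) ∧ e L '' YPoints.primes L = (Y.obj (op L)).X₀) ∧
    ∀ (L L' : AlgFrm.{u}) (α : L ⟶ L') (p : YPoints L'),
      ((e L).symm (PGPSP.fn (Y.map α.op) (e L' p))).1 = rightAdjoint (AlgFrm.fn α) p.1

/-- `V` sends `X` to its admissible closed upsets ordered by reverse inclusion and `f` to the
preimage map. -/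
def IsAdmissibleClosedFunctor (V : PGPSP.{u}ᵒᵖ ⥤ AlgFrm.{u}) : Prop :=
  ∃ e : ∀ X : PGPSP.{u}, {C : Set X // IsAdmissibleClosed X.X₀ C}ᵒᵈ ≃o V.obj (op X),
    ∀ (X X' : PGPSP.{u}) (f : X ⟶ X') (C : {C : Set X' // IsAdmissibleClosed X'.X₀ C}),
      (ofDual ((e X).symm (AlgFrm.fn (V.map f.op) (e X' (toDual C))))).1 = PGPSP.fn f ⁻¹' C.1

/-- `A` sends `X` to its admissible clopen upsets ordered by inclusion and `f` to the preimage
map. -/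
def IsAdmissibleClopenFunctor (A : PGPSP.{u}ᵒᵖ ⥤ DMSP.{u}) : Prop :=
  ∃ e : ∀ X : PGPSP.{u}, {U : Set X // IsAdmissibleClopen X.X₀ U} ≃o A.obj (op X),
    ∀ (X X' : PGPSP.{u}) (f : X ⟶ X') (U : {U : Set X' // IsAdmissibleClopen X'.X₀ U}),
      ((e X).symm (DMSP.fn (A.map f.op) (e X' U))).1 = PGPSP.fn f ⁻¹' U.1

/-- `X` sends `M` to `⟨X_M, Pr(M)⟩` and `α` to the preimage map. -/
def IsOptimalFilterFunctor (X : DMSP.{u}ᵒᵖ ⥤ PGPSP.{u}) : Prop :=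
  ∃ e : ∀ M : DMSP.{u}, XPoints M ≃o X.obj (op M),
    (∀ M, IsHomeomorph (e M) ∧
      e M '' {F | IsPrimeFilter F.1} = (X.obj (op M)).X₀) ∧
    ∀ (M N : DMSP.{u}) (α : M ⟶ N) (F : XPoints N),
      (((e M).symm (PGPSP.fn (X.map α.op) (e N F))).1 : Set M) = DMSP.fn α ⁻¹' (F.1 : Set N)

/-! ### Compact elements, primes and pseudoprimes of an algebraic frame -/

section CompactElements

variable {L : Type u} [CompleteLattice L]

/-! Every element of an algebraic frame is the directed join of the compact elements below it. With
the order reversed, the compact elements form a meet-semilattice whose filters recover the frame.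
Conversely, the compact filters of a semilattice are the principal ones, and distributivity supplies
a Heyting implication of filters. This gives `filterEquivalence`.

The duality with spaces rests on the fact that primes separate elements
(`exists_infPrime_of_not_le`), so that `YPoints.up` is an order-reversing embedding. Pseudoprimes
enter as limits of primes. By `isPseudoprime_or_eq_top_iff`, membership in `YPoints L` is a
condition on compact elements alone. This condition survives ultrafilter limits, which makes the
space compact, and it forces basic neighbourhoods of a pseudoprime to contain a prime
(`YPoints.primes_dense`). Compactness then identifies the admissible closed upsets with the sets `up
a`, and the admissible clopen ones with `up k` for `k` compact.

Conversely, joins of admissible closed upsets are intersections, and meets become unions on `X₀`,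
which already detects the order; hence they form a frame. Its compact elements are the admissible
clopen upsets. Density of `X₀` makes every point pseudoprime or top, and a compactness argument
(`exists_eq_point`) shows that nothing else is; the primes are the points of `X₀`.

The third duality is the composite of the other two, once optimal filters are recognized as
pseudoprimes of the filter frame (`isOptimalFilter_or_iff`). The second part of the theorem combines
the adjunction `a ≤ r b ↔ α a ≤ b` with separation by primes and approximation by compact elements.
-/

theorem isCompact_bot_element : IsCompactElement (⊥ : L) :=
  fun _ _ hs _ _ _ => ⟨hs.some, hs.some_mem, bot_le⟩

theorem IsCompactElement.sup {a b : L} (ha : IsCompactElement a) (hb : IsCompactElement b) :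
    IsCompactElement (a ⊔ b) := by
  intro s u hs hd hu hk
  obtain ⟨x, hx, hax⟩ := ha s u hs hd hu (le_sup_left.trans hk)
  obtain ⟨y, hy, hby⟩ := hb s u hs hd hu (le_sup_right.trans hk)
  obtain ⟨z, hz, hxz, hyz⟩ := hd x hx y hy
  exact ⟨z, hz, sup_le (hax.trans hxz) (hby.trans hyz)⟩

theorem IsCompactElement.exists_le_of_le_sSup {k : L} (hk : IsCompactElement k) {s : Set L}
    (hs : s.Nonempty) (hd : DirectedOn (· ≤ ·) s) (h : k ≤ sSup s) : ∃ x ∈ s, k ≤ x :=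
  hk s _ hs hd (isLUB_sSup s) h

theorem directedOn_compact_le (b : L) :
    DirectedOn (· ≤ ·) {k : L | IsCompactElement k ∧ k ≤ b} :=
  fun x hx y hy => ⟨x ⊔ y, ⟨hx.1.sup hy.1, sup_le hx.2 hy.2⟩, le_sup_left, le_sup_right⟩

theorem nonempty_compact_le (b : L) : {k : L | IsCompactElement k ∧ k ≤ b}.Nonempty :=
  ⟨⊥, isCompact_bot_element, bot_le⟩

theorem exists_compact_le_not_le [IsCompactlyGenerated L] {a b : L} (h : ¬ a ≤ b) :
    ∃ k : L, IsCompactElement k ∧ k ≤ a ∧ ¬ k ≤ b := by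
  rw [le_iff_compact_le_imp] at h
  push Not at h
  exact h

/-- If a map preserves joins, every compact element below `α a` lies below `α k` for some
compact `k ≤ a`. -/
theorem exists_compact_le_map [IsCompactlyGenerated L] {L' : Type u} [CompleteLattice L']
    {α : L → L'} (hα : ∀ s : Set L, α (sSup s) = sSup (α '' s)) (hm : Monotone α) {a : L} {k : L'}
    (hk : IsCompactElement k) (h : k ≤ α a) :
    ∃ c : L, IsCompactElement c ∧ c ≤ a ∧ k ≤ α c := by
  rw [← sSup_compact_le_eq a, hα] at h
  obtain ⟨_, ⟨c, hc, rfl⟩, hkc⟩ := hk.exists_le_of_le_sSup ((nonempty_compact_le a).image α)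
    ((directedOn_compact_le a).mono_comp (fun _ _ h => hm h)) h
  exact ⟨c, hc.1, hc.2, hkc⟩

theorem wayBelow_iff [IsCompactlyGenerated L] {a b : L} :
    WayBelow a b ↔ ∃ k : L, IsCompactElement k ∧ a ≤ k ∧ k ≤ b := by
  constructor
  · intro h
    obtain ⟨T, hT, hfin, haT⟩ := h _ (sSup_compact_le_eq b).ge
    refine ⟨sSup T, ?_, haT, sSup_le fun x hx => (hT hx).2⟩
    have := CompleteLattice.isCompactElement_finsetSup (f := id) hfin.toFinset
      fun x hx => (hT (hfin.mem_toFinset.1 hx)).1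
    rwa [Finset.sup_id_eq_sSup, hfin.coe_toFinset] at this
  · rintro ⟨k, hk, hak, hkb⟩ S hS
    obtain ⟨t, htS, hkt⟩ :=
      (CompleteLattice.isCompactElement_iff_exists_le_sSup_of_le_sSup L k).1 hk S (hkb.trans hS)
    exact ⟨t, htS, t.finite_toSet, hak.trans (hkt.trans (by rw [Finset.sup_id_eq_sSup]))⟩

/-- Shrinking each element to a compact one that is still not below `p` reduces pseudoprimality to
finite sets of compact elements. -/
theorem exists_compact_below_each [IsCompactlyGenerated L] {p : L} {S : Finset L}
    (h : ∀ s ∈ S, ¬ s ≤ p) : ∃ T : Finset L, (S.Nonempty → T.Nonempty) ∧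
      (∀ t ∈ T, IsCompactElement t ∧ ¬ t ≤ p) ∧ T.inf id ≤ S.inf id := by
  classical
  choose! f hf using fun s hs => exists_compact_le_not_le (h s hs)
  refine ⟨S.image f, fun hS => hS.image f, ?_, ?_⟩
  · intro t ht
    obtain ⟨s, hs, rfl⟩ := Finset.mem_image.1 ht
    exact ⟨(hf s hs).1, (hf s hs).2.2⟩
  · refine Finset.le_inf fun s hs => (Finset.inf_le (Finset.mem_image_of_mem f hs)).trans ?_
    exact (hf s hs).2.1

/-- Membership in `Y_L` expressed through compact elements only. -/
theorem isPseudoprime_or_eq_top_iff [IsCompactlyGenerated L] {p : L} :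
    (IsPseudoprime p ∨ p = ⊤) ↔ ∀ S : Finset L, S.Nonempty → (∀ s ∈ S, IsCompactElement s) →
      ∀ k : L, IsCompactElement k → S.inf id ≤ k → k ≤ p → ∃ s ∈ S, s ≤ p := by
  constructor
  · rintro (h | rfl) S hS hc k hk hSk hkp
    · exact h.2 S (wayBelow_iff.2 ⟨k, hk, hSk, hkp⟩)
    · exact ⟨hS.choose, hS.choose_spec, le_top⟩
  · intro h
    refine or_iff_not_imp_right.2 fun hp => ⟨hp, fun S hS => ?_⟩
    obtain ⟨k, hk, hSk, hkp⟩ := wayBelow_iff.1 hS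
    by_contra! hne
    obtain ⟨T, hTne, hT, hTS⟩ := exists_compact_below_each hne
    -- The criterion speaks only of nonempty sets, so that `⊤` satisfies it; an empty meet would
    -- force `p = ⊤`.
    rcases S.eq_empty_or_nonempty with rfl | hSne
    · exact hp (top_le_iff.1 ((by simpa using hSk : (⊤ : L) ≤ k).trans hkp))
    · obtain ⟨t, ht, htp⟩ := h T (hTne hSne) (fun t ht => (hT t ht).1) k hk (hTS.trans hSk) hkp
      exact (hT t ht).2 htp

end CompactElements

section Primes

variable {L : Type u} [Order.Frame L]

theorem InfPrime.isPseudoprime [IsCompactlyGenerated L] {p : L} (hp : InfPrime p) :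
    IsPseudoprime p := by
  refine ⟨hp.ne_top, fun S hS => ?_⟩
  obtain ⟨k, -, hSk, hkp⟩ := wayBelow_iff.1 hS
  exact hp.finset_inf_le.1 (hSk.trans hkp)

/-- Algebraic frames are spatial: primes separate elements. -/
theorem exists_infPrime_of_not_le [IsCompactlyGenerated L] {a b : L} (h : ¬ a ≤ b) :
    ∃ p : L, InfPrime p ∧ b ≤ p ∧ ¬ a ≤ p := by
  obtain ⟨k, hk, hka, hkb⟩ := exists_compact_le_not_le h
  -- An element maximal among those not above a compact `k` is prime; compactness of `k` provides
  -- upper bounds of chains.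
  obtain ⟨p, hbp, hp⟩ := zorn_le_nonempty₀ {q : L | ¬ k ≤ q} (fun c hc hchain y hy => by
    refine ⟨sSup c, fun hkc => ?_, fun z hz => le_sSup hz⟩
    obtain ⟨x, hx, hkx⟩ := hk.exists_le_of_le_sSup ⟨y, hy⟩ hchain.directedOn hkc
    exact hc hx hkx) b hkb
  refine ⟨p, ⟨fun hmax => hp.1 ?_, fun c d hcd => ?_⟩, hbp, fun hap => hp.1 (hka.trans hap)⟩
  · exact le_top.trans (hmax le_top)
  · by_contra! hne
    have key : ∀ e, ¬ e ≤ p → k ≤ p ⊔ e := fun e he => by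
      by_contra hk'
      exact he (le_sup_right.trans (hp.2 hk' le_sup_left))
    -- By distributivity `(p ⊔ c) ⊓ (p ⊔ d) = p ⊔ (c ⊓ d)`, which is below `p`.
    refine hp.1 ((le_inf (key c hne.1) (key d hne.2)).trans ?_)
    rw [← sup_inf_left]
    exact sup_le le_rfl hcd

theorem infPrime_of_compact [IsCompactlyGenerated L] {p : L} (hp : p ≠ ⊤)
    (h : ∀ k l : L, IsCompactElement k → IsCompactElement l → ¬ k ≤ p → ¬ l ≤ p → ¬ k ⊓ l ≤ p) :
    InfPrime p := by
  refine ⟨fun hmax => hp (top_le_iff.1 (hmax le_top)), fun a b hab => ?_⟩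
  by_contra! hne
  obtain ⟨k, hk, hka, hkp⟩ := exists_compact_le_not_le hne.1
  obtain ⟨l, hl, hlb, hlp⟩ := exists_compact_le_not_le hne.2
  exact h k l hk hl hkp hlp ((inf_le_inf hka hlb).trans hab)

end Primes

section RightAdjoint

variable {L L' : Type u} [CompleteLattice L] [CompleteLattice L']

theorem le_rightAdjoint_iff {α : L → L'} (hα : ∀ s : Set L, α (sSup s) = sSup (α '' s))
    (hm : Monotone α) {a : L} {b : L'} : a ≤ rightAdjoint α b ↔ α a ≤ b := by
  constructor
  · intro h
    refine (hm h).trans ?_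
    rw [rightAdjoint, hα]
    exact sSup_le (by rintro _ ⟨x, hx, rfl⟩; exact hx)
  · exact fun h => le_sSup h

end RightAdjoint

/-! ### Admissible sets in compact ordered spaces -/

section AdmissibleSets

variable {X : Type u} [TopologicalSpace X] [PartialOrder X]

theorem IsAdmissibleClosed.exists_le {X₀ C : Set X} (hC : IsAdmissibleClosed X₀ C) {x : X}
    (hx : x ∉ C) : ∃ y ∈ X₀, y ∉ C ∧ x ≤ y := by
  have : x ∈ Cᶜ := hx
  rw [hC.2.2] at this
  obtain ⟨y, ⟨hy, hyC⟩, hxy⟩ := this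
  exact ⟨y, hy, hyC, hxy⟩

theorem isAdmissibleClosed_of_exists_le {X₀ C : Set X} (hc : IsClosed C) (hu : IsUpperSet C)
    (h : ∀ x ∉ C, ∃ y ∈ X₀, y ∉ C ∧ x ≤ y) : IsAdmissibleClosed X₀ C := by
  refine ⟨hc, hu, Set.Subset.antisymm (fun x hx => ?_) ?_⟩
  · obtain ⟨y, hy, hyC, hxy⟩ := h x hx
    exact ⟨y, ⟨hy, hyC⟩, hxy⟩
  · rintro x ⟨y, ⟨-, hyC⟩, hxy⟩ hx
    exact hyC (hu hxy hx)

/-- Every point outside `D` lies below a point of `X₀` outside `D`, so inclusions can be tested on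
`X₀`. -/
theorem IsAdmissibleClosed.subset_iff {X₀ C D : Set X} (hC : IsUpperSet C)
    (hD : IsAdmissibleClosed X₀ D) : C ⊆ D ↔ ∀ y ∈ X₀, y ∈ C → y ∈ D := by
  refine ⟨fun h y _ hy => h hy, fun h x hx => ?_⟩
  by_contra hxD
  obtain ⟨y, hy, hyD, hxy⟩ := hD.exists_le hxD
  exact hyD (h y hy (hC hxy hx))

theorem IsAdmissibleClosed.sInter {X₀ : Set X} {S : Set (Set X)}
    (h : ∀ C ∈ S, IsAdmissibleClosed X₀ C) : IsAdmissibleClosed X₀ (⋂₀ S) := by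
  refine isAdmissibleClosed_of_exists_le (isClosed_sInter fun C hC => (h C hC).1)
    (isUpperSet_sInter fun C hC => (h C hC).2.1) fun x hx => ?_
  simp only [Set.mem_sInter, not_forall] at hx
  obtain ⟨C, hCS, hxC⟩ := hx
  obtain ⟨y, hy, hyC, hxy⟩ := (h C hCS).exists_le hxC
  exact ⟨y, hy, fun hyS => hyC (hyS C hCS), hxy⟩

theorem IsAdmissibleClosed.inter {X₀ C D : Set X} (hC : IsAdmissibleClosed X₀ C)
    (hD : IsAdmissibleClosed X₀ D) : IsAdmissibleClosed X₀ (C ∩ D) := by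
  rw [← Set.sInter_pair]
  exact IsAdmissibleClosed.sInter (by rintro _ (rfl | rfl) <;> assumption)

variable [PriestleySpace X]

theorem PriestleySpace.isClosed_Ici (x : X) : IsClosed (Set.Ici x) := by
  have : Set.Ici x = ⋂₀ {U | IsClopen U ∧ IsUpperSet U ∧ x ∈ U} := by
    ext y
    refine ⟨fun hxy U hU => hU.2.1 hxy hU.2.2, fun h => ?_⟩
    by_contra hxy
    obtain ⟨U, hU, hup, hx, hy⟩ := exists_isClopen_upper_of_not_le hxy
    exact hy (h U ⟨hU, hup, hx⟩)
  rw [this]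
  exact isClosed_sInter fun U hU => hU.1.1

variable [CompactSpace X]

/-- Zorn's lemma: for `z` in a chain, the sets `Set.Ici z ∩ F` are closed, nonempty and directed, so
compactness gives them a common point, which bounds the chain. -/
theorem PriestleySpace.exists_maximal {F : Set X} (hF : IsClosed F) {x : X} (hx : x ∈ F) :
    ∃ y, x ≤ y ∧ Maximal (· ∈ F) y := by
  refine zorn_le_nonempty₀ F (fun c hc hchain y hy => ?_) x hx
  have := IsCompact.nonempty_sInter_of_directed_nonempty_isCompact_isClosed
    (hS := (Set.Nonempty.image (fun z => Set.Ici z ∩ F) ⟨y, hy⟩).to_subtype) ?_ ?_ ?_ ?_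
  · obtain ⟨u, hu⟩ := this
    have hu' : ∀ z ∈ c, u ∈ Set.Ici z ∩ F := fun z hz => hu _ ⟨z, hz, rfl⟩
    exact ⟨u, (hu' y hy).2, fun z hz => (hu' z hz).1⟩
  · rintro _ ⟨a, ha, rfl⟩ _ ⟨b, hb, rfl⟩
    obtain ⟨d, hd, had, hbd⟩ := hchain.directedOn a ha b hb
    exact ⟨_, ⟨d, hd, rfl⟩, Set.inter_subset_inter_left _ (Set.Ici_subset_Ici.2 had),
      Set.inter_subset_inter_left _ (Set.Ici_subset_Ici.2 hbd)⟩
  · rintro _ ⟨a, ha, rfl⟩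
    exact ⟨a, le_rfl, hc ha⟩
  · rintro _ ⟨a, ha, rfl⟩
    exact ((PriestleySpace.isClosed_Ici a).inter hF).isCompact
  · rintro _ ⟨a, ha, rfl⟩
    exact (PriestleySpace.isClosed_Ici a).inter hF

/-- The complement of an open set is closed, hence each of its points lies below a maximal one.
Conversely, a maximal point of the complement equals any point of the complement above it. -/
theorem isAdmissibleClopen_iff {X₀ U : Set X} :
    IsAdmissibleClopen X₀ U ↔ IsAdmissibleClosed X₀ U ∧ IsOpen U := by
  constructor
  · rintro ⟨hU, hup, hmax⟩
    refine ⟨isAdmissibleClosed_of_exists_le hU.1 hup fun x hx => ?_, hU.2⟩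
    obtain ⟨y, hxy, hy⟩ := PriestleySpace.exists_maximal hU.2.isClosed_compl
      (show x ∈ Uᶜ from hx)
    exact ⟨y, hmax hy, hy.1, hxy⟩
  · rintro ⟨hU, ho⟩
    refine ⟨⟨hU.1, ho⟩, hU.2.1, fun x hx => ?_⟩
    obtain ⟨y, hy, hyU, hxy⟩ := hU.exists_le hx.1
    exact le_antisymm hxy (hx.2 hyU hxy) ▸ hy

theorem IsAdmissibleClopen.inter {X₀ U V : Set X} (hU : IsAdmissibleClopen X₀ U)
    (hV : IsAdmissibleClopen X₀ V) : IsAdmissibleClopen X₀ (U ∩ V) := by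
  rw [isAdmissibleClopen_iff] at *
  exact ⟨hU.1.inter hV.1, hU.2.inter hV.2⟩

end AdmissibleSets

/-! ### The space `Y_L` -/

section YSpace

variable {L : Type u} [Order.Frame L]

namespace YPoints

theorem topology_eq : YPoints.topology L = TopologicalSpace.generateFrom
    ({U | ∃ k : L, IsCompactElement k ∧ U = {p : YPoints L | k ≤ p.1}} ∪
      {U | ∃ k : L, IsCompactElement k ∧ U = {p : YPoints L | k ≤ p.1}ᶜ}) := by
  rw [YPoints.topology, algebraicTopology, induced_generateFrom_eq, Set.image_union]
  congr 2
  · ext U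
    constructor
    · rintro ⟨_, ⟨k, hk, rfl⟩, rfl⟩
      exact ⟨k, hk, rfl⟩
    · rintro ⟨k, hk, rfl⟩
      exact ⟨_, ⟨k, hk, rfl⟩, rfl⟩
  · ext U
    constructor
    · rintro ⟨_, ⟨k, hk, rfl⟩, rfl⟩
      exact ⟨k, hk, rfl⟩
    · rintro ⟨k, hk, rfl⟩
      exact ⟨_, ⟨k, hk, rfl⟩, rfl⟩

/-- The set of points of `Y_L` above `a`. -/
def up (a : L) : Set (YPoints L) := {p | a ≤ p.1}

theorem isUpperSet_up (a : L) : IsUpperSet (up a) := fun _ _ hpq hp => le_trans hp hpq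

theorem isClopen_up {k : L} (hk : IsCompactElement k) : IsClopen (up k) := by
  constructor
  · rw [← isOpen_compl_iff, topology_eq]
    exact TopologicalSpace.isOpen_generateFrom_of_mem (Or.inr ⟨k, hk, rfl⟩)
  · rw [topology_eq]
    exact TopologicalSpace.isOpen_generateFrom_of_mem (Or.inl ⟨k, hk, rfl⟩)

theorem up_sSup (s : Set L) : up (sSup s) = ⋂ a ∈ s, up a := by
  ext p
  simp [up]

/-- One positive condition `k` suffices because compact elements are closed under binary joins. -/
theorem exists_basic_nhd {p : YPoints L} {O : Set (YPoints L)} (hO : IsOpen O) (hp : p ∈ O) :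
    ∃ (k : L) (T : Finset L), IsCompactElement k ∧ k ≤ p.1 ∧
      (∀ l ∈ T, IsCompactElement l ∧ ¬ l ≤ p.1) ∧
      ∀ q : YPoints L, k ≤ q.1 → (∀ l ∈ T, ¬ l ≤ q.1) → q ∈ O := by
  classical
  rw [topology_eq] at hO
  induction hO with
  | basic U hU =>
    obtain ⟨k, hk, rfl⟩ | ⟨k, hk, rfl⟩ := hU
    · exact ⟨k, ∅, hk, hp, by simp, fun q hq _ => hq⟩
    · exact ⟨⊥, {k}, isCompact_bot_element, bot_le, by simpa using ⟨hk, hp⟩,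
        fun q _ hq => hq k (Finset.mem_singleton_self k)⟩
  | univ => exact ⟨⊥, ∅, isCompact_bot_element, bot_le, by simp, fun _ _ _ => trivial⟩
  | inter U V _ _ ihU ihV =>
    obtain ⟨k, T, hk, hkp, hT, hU⟩ := ihU hp.1
    obtain ⟨l, S, hl, hlp, hS, hV⟩ := ihV hp.2
    refine ⟨k ⊔ l, T ∪ S, hk.sup hl, sup_le hkp hlp, fun x hx => ?_, fun q hq hTS => ?_⟩
    · exact (Finset.mem_union.1 hx).elim (hT x) (hS x)
    · exact ⟨hU q (le_sup_left.trans hq) fun x hx => hTS x (Finset.mem_union_left _ hx),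
        hV q (le_sup_right.trans hq) fun x hx => hTS x (Finset.mem_union_right _ hx)⟩
  | sUnion S _ ih =>
    obtain ⟨U, hU, hpU⟩ := hp
    obtain ⟨k, T, hk, hkp, hT, h⟩ := ih U hU hpU
    exact ⟨k, T, hk, hkp, hT, fun q hq hqT => ⟨U, hU, h q hq hqT⟩⟩

variable [IsCompactlyGenerated L]

theorem up_subset_up {a b : L} : up a ⊆ up b ↔ b ≤ a := by
  refine ⟨fun h => ?_, fun h p hp => h.trans hp⟩
  by_contra hba
  obtain ⟨p, hp, hap, hbp⟩ := exists_infPrime_of_not_le hba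
  exact hbp (h (show (⟨p, Or.inl hp.isPseudoprime⟩ : YPoints L) ∈ up a from hap))

theorem isClosed_up (a : L) : IsClosed (up a) := by
  rw [← sSup_compact_le_eq a, up_sSup]
  exact isClosed_biInter fun k hk => (isClopen_up hk.1).1

/-- An ultrafilter converges to the join of the compact `k` with `up k` in it. That join lies in
`YPoints L` because an ultrafilter containing a finite union contains one of its members. -/
instance : CompactSpace (YPoints L) := by
  classical
  refine ⟨isCompact_iff_ultrafilter_le_nhds.2 fun F _ => ?_⟩
  set D : Set L := {k | IsCompactElement k ∧ up k ∈ F}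
  have hdir : DirectedOn (· ≤ ·) D := fun x hx y hy => by
    refine ⟨x ⊔ y, ⟨hx.1.sup hy.1, Filter.mem_of_superset (Filter.inter_mem hx.2 hy.2) ?_⟩,
      le_sup_left, le_sup_right⟩
    exact fun p hp => sup_le hp.1 hp.2
  have hne : D.Nonempty :=
    ⟨⊥, isCompact_bot_element, Filter.mem_of_superset Filter.univ_mem fun p _ => bot_le⟩
  have hmem : ∀ k : L, IsCompactElement k → (k ≤ sSup D ↔ up k ∈ F) := fun k hk => by
    refine ⟨fun h => ?_, fun h => le_sSup ⟨hk, h⟩⟩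
    obtain ⟨l, hl, hkl⟩ := hk.exists_le_of_le_sSup hne hdir h
    exact Filter.mem_of_superset hl.2 (up_subset_up.2 hkl)
  have hp : IsPseudoprime (sSup D) ∨ sSup D = ⊤ := by
    refine isPseudoprime_or_eq_top_iff.2 fun S hS hc k hk hSk hkp => ?_
    have : (⋃ s ∈ (S : Set L), up s) ∈ F := by
      refine Filter.mem_of_superset ((hmem k hk).1 hkp) fun p hp => ?_
      obtain ⟨s, hs, hsp⟩ := isPseudoprime_or_eq_top_iff.1 p.2 S hS hc k hk hSk hp
      exact Set.mem_biUnion hs hsp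
    obtain ⟨s, hs, hsF⟩ := (Ultrafilter.finite_biUnion_mem_iff S.finite_toSet).1 this
    exact ⟨s, hs, (hmem s (hc s hs)).2 hsF⟩
  refine ⟨⟨sSup D, hp⟩, Set.mem_univ _, ?_⟩
  rw [topology_eq, TopologicalSpace.nhds_generateFrom]
  refine le_iInf₂ fun U hU => Filter.le_principal_iff.2 ?_
  obtain ⟨hpU, ⟨k, hk, rfl⟩ | ⟨k, hk, rfl⟩⟩ := hU
  · exact (hmem k hk).1 hpU
  · exact Ultrafilter.compl_mem_iff_notMem.2 fun h => hpU ((hmem k hk).2 h)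

instance : PriestleySpace (YPoints L) := ⟨fun {p q} hpq => by
  obtain ⟨k, hk, hkp, hkq⟩ := exists_compact_le_not_le hpq
  exact ⟨up k, isClopen_up hk, isUpperSet_up k, hkp, hkq⟩⟩

theorem isAdmissibleClosed_up (a : L) : IsAdmissibleClosed (primes L) (up a) := by
  refine isAdmissibleClosed_of_exists_le (isClosed_up a) (isUpperSet_up a) fun p hp => ?_
  obtain ⟨q, hq, hpq, haq⟩ := exists_infPrime_of_not_le hp
  exact ⟨⟨q, Or.inl hq.isPseudoprime⟩, hq, haq, hpq⟩

theorem isAdmissibleClopen_up {k : L} (hk : IsCompactElement k) :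
    IsAdmissibleClopen (primes L) (up k) :=
  isAdmissibleClopen_iff.2 ⟨isAdmissibleClosed_up k, (isClopen_up hk).2⟩

/-- The witness is the meet of `C`. A point above it but outside `C` lies below a prime `q` outside
`C`; compactness of `C` yields finitely many compact elements not below `q` whose meet is below
every point of `C`, hence below `q`, against primality. -/
theorem exists_eq_up {C : Set (YPoints L)} (hC : IsAdmissibleClosed (primes L) C) :
    ∃ a : L, C = up a := by
  refine ⟨⨅ c ∈ C, c.1, Set.Subset.antisymm (fun c hc => iInf₂_le c hc) fun p hp => ?_⟩
  by_contra hpC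
  obtain ⟨q, hq, hqC, hpq⟩ := hC.exists_le hpC
  have hex : ∀ c : YPoints L, c ∈ C → ∃ k : L, IsCompactElement k ∧ k ≤ c.1 ∧ ¬ k ≤ q.1 :=
    fun c hc => exists_compact_le_not_le fun hcq => hqC (hC.2.1 hcq hc)
  choose! k hk hkc hkq using hex
  obtain ⟨t, htC, hcover⟩ := hC.1.isCompact.elim_nhds_subcover (fun c => up (k c))
    fun c hc => (isClopen_up (hk c hc)).2.mem_nhds (hkc c hc)
  have : t.inf k ≤ q.1 := by
    refine le_trans (le_iInf₂ fun c hc => ?_) (le_trans hp hpq)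
    obtain ⟨d, hd, hdc⟩ := Set.mem_iUnion₂.1 (hcover hc)
    exact (Finset.inf_le hd).trans hdc
  obtain ⟨c, hc, hcq⟩ := InfPrime.finset_inf_le hq |>.1 this
  exact hkq c (htC c hc) hcq

/-- The set `up a` is the directed intersection of the clopen sets `up k`, with `k ≤ a` compact. If
it is also open, compactness makes it equal to one of them. -/
theorem exists_eq_up_compact {U : Set (YPoints L)} (hU : IsAdmissibleClopen (primes L) U) :
    ∃ k : L, IsCompactElement k ∧ U = up k := by
  obtain ⟨hc, ho⟩ := isAdmissibleClopen_iff.1 hU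
  obtain ⟨a, rfl⟩ := exists_eq_up hc
  have := IsCompact.nonempty_sInter_of_directed_nonempty_isCompact_isClosed
    (hS := ((nonempty_compact_le a).image fun k => up k \ up a).to_subtype) ?_
  · by_contra! hne
    obtain ⟨p, hp⟩ := this (by
      rintro _ ⟨k, hk, rfl⟩
      by_contra! hemp
      refine hne k hk.1 (Set.Subset.antisymm (up_subset_up.2 hk.2) ?_)
      exact Set.sdiff_eq_empty.1 hemp) (by
      rintro _ ⟨k, hk, rfl⟩
      exact ((isClopen_up hk.1).1.sdiff ho).isCompact) (by
      rintro _ ⟨k, hk, rfl⟩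
      exact (isClopen_up hk.1).1.sdiff ho)
    have hp' : ∀ k, IsCompactElement k → k ≤ a → p ∈ up k \ up a :=
      fun k hk hka => hp _ ⟨k, ⟨hk, hka⟩, rfl⟩
    refine (hp' ⊥ isCompact_bot_element bot_le).2 ?_
    exact le_iff_compact_le_imp.2 fun k hk hka => (hp' k hk hka).1
  · rintro _ ⟨k, hk, rfl⟩ _ ⟨l, hl, rfl⟩
    exact ⟨_, ⟨k ⊔ l, ⟨hk.1.sup hl.1, sup_le hk.2 hl.2⟩, rfl⟩,
      Set.sdiff_subset_sdiff_left (up_subset_up.2 le_sup_left),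
      Set.sdiff_subset_sdiff_left (up_subset_up.2 le_sup_right)⟩

/-- Pseudoprimality says that the meet of `T` is not below `k`; a prime above `k` separating the two
lies in the basic neighbourhood given by `k` and `T`. -/
theorem primes_dense (p : YPoints L) (hp : p.1 ≠ ⊤) : p ∈ closure (primes L) := by
  refine mem_closure_iff.2 fun O hO hpO => ?_
  obtain ⟨k, T, hk, hkp, hT, hsub⟩ := exists_basic_nhd hO hpO
  have hnle : ¬ T.inf id ≤ k := by
    intro h
    rcases T.eq_empty_or_nonempty with rfl | hne
    · exact hp (top_le_iff.1 ((by simpa using h : (⊤ : L) ≤ k).trans hkp))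
    · obtain ⟨l, hl, hlp⟩ := isPseudoprime_or_eq_top_iff.1 p.2 T hne (fun l hl => (hT l hl).1)
        k hk h hkp
      exact (hT l hl).2 hlp
  obtain ⟨q, hq, hkq, hTq⟩ := exists_infPrime_of_not_le hnle
  exact ⟨⟨q, Or.inl hq.isPseudoprime⟩,
    hsub _ hkq fun l hl hlq => hTq ((Finset.inf_le hl).trans hlq), hq⟩

end YPoints

/-- The pointed generalized Priestley space `⟨Y_L, P(L), 1⟩`. -/
def YPoints.space (L : AlgFrm.{u}) : PGPSP.{u} where
  carrier := YPoints L
  X₀ := primes L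
  m := ⟨⊤, Or.inr rfl⟩
  le_m _ := le_top (α := L)
  X₀_subset := fun p hp h => InfPrime.ne_top hp (congrArg Subtype.val h)
  X₀_dense := fun p hp => primes_dense p fun h => hp (Subtype.ext h)
  X₀_orderDense := fun p hp => by
    obtain ⟨q, hq, hpq, -⟩ := exists_infPrime_of_not_le (L := L) (a := ⊤) (b := p.1)
      fun h => hp (Subtype.ext (top_le_iff.1 h))
    exact ⟨⟨q, Or.inl hq.isPseudoprime⟩, hq, hpq⟩
  mem_X₀_iff := fun p => by
    constructor
    · intro hp
      constructor
      · obtain ⟨k, hk, -, hkp⟩ := exists_compact_le_not_le (L := L) (a := ⊤) (b := p.1)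
          fun h => InfPrime.ne_top hp (top_le_iff.1 h)
        exact ⟨_, isAdmissibleClopen_up hk, hkp⟩
      · rintro U ⟨hU, hpU⟩ V ⟨hV, hpV⟩
        obtain ⟨k, hk, rfl⟩ := exists_eq_up_compact hU
        obtain ⟨l, hl, rfl⟩ := exists_eq_up_compact hV
        -- Primality gives `¬ k ⊓ l ≤ p`; a compact witness `n` of this gives a member of the family
        -- containing both sets.
        obtain ⟨n, hn, hnkl, hnp⟩ := exists_compact_le_not_le (L := L) (a := k ⊓ l) (b := p.1)
          fun h => (hp.2 h).elim hpU hpV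
        exact ⟨up n, ⟨isAdmissibleClopen_up hn, hnp⟩,
          up_subset_up.2 (hnkl.trans inf_le_left), up_subset_up.2 (hnkl.trans inf_le_right)⟩
    · rintro ⟨⟨U, hU, hpU⟩, hdir⟩
      refine infPrime_of_compact (fun h => ?_) fun k l hk hl hkp hlp hklp => ?_
      -- Nonemptiness of the family excludes `p = ⊤`, which lies in every `up k`.
      · obtain ⟨k, hk, rfl⟩ := exists_eq_up_compact hU
        exact hpU (le_top.trans h.ge)
      · obtain ⟨W, ⟨hW, hpW⟩, hkW, hlW⟩ := hdir _ ⟨isAdmissibleClopen_up hk, hkp⟩ _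
          ⟨isAdmissibleClopen_up hl, hlp⟩
        obtain ⟨n, hn, rfl⟩ := exists_eq_up_compact hW
        exact hpW ((le_inf (up_subset_up.1 hkW) (up_subset_up.1 hlW)).trans hklp)
  le_iff := fun p q => by
    refine ⟨fun hpq U hU hp => hU.2.1 hpq hp, fun h => ?_⟩
    refine le_iff_compact_le_imp.2 fun k hk hkp => ?_
    exact h _ (isAdmissibleClopen_up hk) hkp

end YSpace

/-! ### The action of `Y` on morphisms -/

section YMap

variable {L L' : Type u} [Order.Frame L] [Order.Frame L']

theorem le_rightAdjoint_frameHom_iff (f : FrameHom L L') {a : L} {b : L'} :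
    a ≤ rightAdjoint f b ↔ f a ≤ b :=
  le_rightAdjoint_iff (map_sSup f) (OrderHomClass.mono f)

theorem infPrime_rightAdjoint (f : FrameHom L L') {p : L'} (hp : InfPrime p) :
    InfPrime (rightAdjoint f p) := by
  refine ⟨fun hmax => hp.ne_top ?_, fun a b hab => ?_⟩
  · have : (⊤ : L) ≤ rightAdjoint f p := hmax le_top
    rwa [le_rightAdjoint_frameHom_iff, map_top, top_le_iff] at this
  · rw [le_rightAdjoint_frameHom_iff, map_inf] at hab
    simpa only [le_rightAdjoint_frameHom_iff] using hp.2 hab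

variable [IsCompactlyGenerated L] [IsCompactlyGenerated L']

/-- Through the adjunction, the compact criterion at `rightAdjoint f p` for `S` and `k` becomes the
criterion at `p` for the images under `f`. -/
theorem rightAdjoint_mem_YPoints (f : FrameHom L L')
    (hf : ∀ k : L, IsCompactElement k → IsCompactElement (f k)) (p : YPoints L') :
    IsPseudoprime (rightAdjoint f p.1) ∨ rightAdjoint f p.1 = ⊤ := by
  classical
  refine isPseudoprime_or_eq_top_iff.2 fun S hS hc k hk hSk hkp => ?_
  obtain ⟨t, ht, htp⟩ := isPseudoprime_or_eq_top_iff.1 p.2 (S.image f) (hS.image f)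
    (by simpa using fun s hs => hf s (hc s hs)) (f k) (hf k hk)
    (by
      have := OrderHomClass.mono f hSk
      rwa [map_finset_inf, Function.comp_id, ← Function.id_comp f, ← Finset.inf_image] at this)
    (le_rightAdjoint_frameHom_iff f |>.1 hkp)
  obtain ⟨s, hs, rfl⟩ := Finset.mem_image.1 ht
  exact ⟨s, hs, le_rightAdjoint_frameHom_iff f |>.2 htp⟩

/-- The restriction of the right adjoint to `Y_L`. -/
def YPoints.map (f : FrameHom L L')
    (hf : ∀ k : L, IsCompactElement k → IsCompactElement (f k)) (p : YPoints L') : YPoints L :=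
  ⟨rightAdjoint f p.1, rightAdjoint_mem_YPoints f hf p⟩

theorem YPoints.preimage_map_up (f : FrameHom L L')
    (hf : ∀ k : L, IsCompactElement k → IsCompactElement (f k)) (a : L) :
    YPoints.map f hf ⁻¹' up a = up (f a) :=
  Set.ext fun _ => le_rightAdjoint_frameHom_iff f

theorem YPoints.isStrongPriestley_map (f : FrameHom L L')
    (hf : ∀ k : L, IsCompactElement k → IsCompactElement (f k)) :
    IsStrongPriestley (primes L') (primes L) (YPoints.map f hf) := by
  refine ⟨fun p q hpq => ?_, fun U hU => ?_⟩
  · exact (le_rightAdjoint_frameHom_iff f).2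
      (((le_rightAdjoint_frameHom_iff f).1 le_rfl).trans hpq)
  · obtain ⟨k, hk, rfl⟩ := exists_eq_up_compact hU
    rw [preimage_map_up]
    exact isAdmissibleClopen_up (hf k hk)

end YMap

/-! ### The frame of admissible closed upsets -/

namespace PGPSP

variable {X : PGPSP.{u}}

theorem exists_superset_of_finite {x : X} (hx : x ∈ X.X₀) {S : Set (Set X)} (hS : S.Finite)
    (h : ∀ U ∈ S, IsAdmissibleClopen X.X₀ U ∧ x ∉ U) :
    ∃ U, IsAdmissibleClopen X.X₀ U ∧ x ∉ U ∧ ⋃₀ S ⊆ U := by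
  obtain ⟨hne, hdir⟩ := (X.mem_X₀_iff x).1 hx
  induction S, hS using Set.Finite.induction_on with
  | empty => exact ⟨_, hne.some_mem.1, hne.some_mem.2, by simp⟩
  | @insert V S _ _ ih =>
    obtain ⟨U, hU, hxU, hSU⟩ := ih fun W hW => h W (Set.mem_insert_of_mem _ hW)
    obtain ⟨W, ⟨hW, hxW⟩, hUW, hVW⟩ := hdir U ⟨hU, hxU⟩ V (h V (Set.mem_insert _ _))
    refine ⟨W, hW, hxW, ?_⟩
    rw [Set.sUnion_insert]
    exact Set.union_subset hVW (hSU.trans hUW)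

/-- A closed upset missing a point of `X₀` is contained in an admissible clopen upset missing
that point. -/
theorem exists_isAdmissibleClopen_superset {C : Set X} (hC : IsClosed C) (hup : IsUpperSet C)
    {x : X} (hx : x ∈ X.X₀) (hxC : x ∉ C) :
    ∃ U, IsAdmissibleClopen X.X₀ U ∧ x ∉ U ∧ C ⊆ U := by
  classical
  have hex : ∀ c ∈ C, ∃ U, IsAdmissibleClopen X.X₀ U ∧ x ∉ U ∧ c ∈ U := by
    intro c hc
    -- The order axiom separates each `c` from `x`; a finite subcover is then absorbed into one
    -- admissible set by directedness at `x`.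
    have : ¬ c ≤ x := fun h => hxC (hup h hc)
    rw [X.le_iff] at this
    push Not at this
    obtain ⟨U, hU, hcU, hxU⟩ := this
    exact ⟨U, hU, hxU, hcU⟩
  choose! U hU hxU hcU using hex
  obtain ⟨t, htC, hcover⟩ := hC.isCompact.elim_nhds_subcover U
    fun c hc => (hU c hc).1.2.mem_nhds (hcU c hc)
  obtain ⟨W, hW, hxW, hUW⟩ := exists_superset_of_finite hx (S := U '' t)
    (t.finite_toSet.image U) (by
      rintro _ ⟨c, hc, rfl⟩
      exact ⟨hU c (htC c hc), hxU c (htC c hc)⟩)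
  refine ⟨W, hW, hxW, hcover.trans (Set.iUnion₂_subset fun c hc => ?_)⟩
  exact (Set.subset_sUnion_of_mem (Set.mem_image_of_mem U hc)).trans hUW

theorem isAdmissibleClosed_eq_sInter {C : Set X} (hC : IsAdmissibleClosed X.X₀ C) :
    C = ⋂₀ {U | IsAdmissibleClopen X.X₀ U ∧ C ⊆ U} := by
  refine Set.Subset.antisymm (fun x hx U hU => hU.2 hx) fun x hx => ?_
  by_contra hxC
  obtain ⟨y, hy, hyC, hxy⟩ := hC.exists_le hxC
  obtain ⟨U, hU, hyU, hCU⟩ := exists_isAdmissibleClopen_superset hC.1 hC.2.1 hy hyC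
  exact hyU (hU.2.1 hxy (hx U ⟨hU, hCU⟩))

/-- The least admissible closed upset containing a closed upset. -/
def admissibleHull (C : Set X) : Set X := {x | ∀ y ∈ X.X₀, x ≤ y → y ∈ C}

theorem subset_admissibleHull {C : Set X} (hup : IsUpperSet C) : C ⊆ admissibleHull C :=
  fun _ hx _ _ hxy => hup hxy hx

/-- For closedness: a point outside the hull lies below some `y ∈ X₀` outside `C`, and `y` is missed
by an admissible clopen `U ⊇ C`. The complement of `U` is a neighbourhood of the point, and each of
its members lies below a point of `X₀` outside `U`, hence misses the hull. -/
theorem isAdmissibleClosed_admissibleHull {C : Set X} (hC : IsClosed C) (hup : IsUpperSet C) :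
    IsAdmissibleClosed X.X₀ (admissibleHull C) := by
  refine isAdmissibleClosed_of_exists_le ?_ (fun x y hxy hx z hz hyz => hx z hz (hxy.trans hyz))
    fun x hx => ?_
  · rw [← isOpen_compl_iff, isOpen_iff_mem_nhds]
    intro x hx
    simp only [admissibleHull, Set.mem_compl_iff, Set.mem_ofPred_eq, not_forall] at hx
    obtain ⟨y, hy, hxy, hyC⟩ := hx
    obtain ⟨U, hU, hyU, hCU⟩ := exists_isAdmissibleClopen_superset hC hup hy hyC
    refine Filter.mem_of_superset
      (hU.1.compl.2.mem_nhds (show x ∈ Uᶜ from fun hxU => hyU (hU.2.1 hxy hxU))) fun z hz hz' => ?_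
    obtain ⟨w, hw, hwU, hzw⟩ := (isAdmissibleClopen_iff.1 hU).1.exists_le hz
    exact hwU (hCU (hz' w hw hzw))
  · simp only [admissibleHull, Set.mem_ofPred_eq, not_forall] at hx
    obtain ⟨y, hy, hxy, hyC⟩ := hx
    exact ⟨y, hy, fun h => hyC (h y hy le_rfl), hxy⟩

theorem isAdmissibleClosed_Ici (x : X) : IsAdmissibleClosed X.X₀ (Set.Ici x) := by
  have : Set.Ici x = ⋂₀ {U | IsAdmissibleClopen X.X₀ U ∧ x ∈ U} := by
    ext y
    rw [Set.mem_Ici, X.le_iff]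
    exact ⟨fun h U hU => h U hU.1 hU.2, fun h U hU hx => h U ⟨hU, hx⟩⟩
  rw [this]
  exact IsAdmissibleClosed.sInter fun U hU => (isAdmissibleClopen_iff.1 hU.1).1

/-- Admissible closed upsets ordered by reverse inclusion. -/
abbrev ClosedUpsets (X : PGPSP.{u}) : Type u := {C : Set X // IsAdmissibleClosed X.X₀ C}ᵒᵈ

/-- The underlying set of an admissible closed upset. -/
def ClosedUpsets.set (C : ClosedUpsets X) : Set X := (ofDual C).1

theorem ClosedUpsets.prop (C : ClosedUpsets X) : IsAdmissibleClosed X.X₀ C.set := (ofDual C).2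

/-- The element of the frame given by an admissible closed upset. -/
def ClosedUpsets.mk (C : Set X) (hC : IsAdmissibleClosed X.X₀ C) : ClosedUpsets X :=
  toDual ⟨C, hC⟩

theorem ClosedUpsets.le_iff {C D : ClosedUpsets X} : C ≤ D ↔ D.set ⊆ C.set := Iff.rfl

theorem ClosedUpsets.ext {C D : ClosedUpsets X} (h : C.set = D.set) : C = D :=
  congrArg toDual (Subtype.ext h)

instance : SupSet (ClosedUpsets X) :=
  ⟨fun S => ClosedUpsets.mk (⋂₀ (ClosedUpsets.set '' S)) (IsAdmissibleClosed.sInter (by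
    rintro _ ⟨C, -, rfl⟩
    exact C.prop))⟩

instance : CompleteLattice (ClosedUpsets X) where
  __ := completeLatticeOfSup (ClosedUpsets X) fun S =>
    ⟨fun C hC => Set.sInter_subset_of_mem ⟨C, hC, rfl⟩, fun D hD => Set.subset_sInter (by
      rintro _ ⟨C, hC, rfl⟩
      exact hD hC)⟩
  inf C D := ClosedUpsets.mk (admissibleHull (C.set ∪ D.set))
    (isAdmissibleClosed_admissibleHull (C.prop.1.union D.prop.1) (C.prop.2.1.union D.prop.2.1))
  inf_le_left C D := Set.subset_union_left.trans
    (subset_admissibleHull (C.prop.2.1.union D.prop.2.1))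
  inf_le_right C D := Set.subset_union_right.trans
    (subset_admissibleHull (C.prop.2.1.union D.prop.2.1))
  le_inf E C D hC hD := by
    intro x hx
    by_contra hxE
    obtain ⟨y, hy, hyE, hxy⟩ := E.prop.exists_le hxE
    exact (hx y hy hxy).elim (fun h => hyE (hC h)) fun h => hyE (hD h)

/-! ### The frame structure on admissible closed upsets and its compact elements. -/

namespace ClosedUpsets

theorem set_sSup (S : Set (ClosedUpsets X)) : (sSup S).set = ⋂₀ (set '' S) := rfl

/-- The hull adds no point of `X₀`. Since `X₀` detects the order, the frame law reduces to
distributivity of unions over intersections of sets. -/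
theorem mem_set_inf {C D : ClosedUpsets X} {x : X} (hx : x ∈ X.X₀) :
    x ∈ (C ⊓ D).set ↔ x ∈ C.set ∨ x ∈ D.set :=
  ⟨fun h => h x hx le_rfl, fun h => subset_admissibleHull (C.prop.2.1.union D.prop.2.1) h⟩

theorem le_iff_X₀ {C D : ClosedUpsets X} : C ≤ D ↔ ∀ x ∈ X.X₀, x ∈ D.set → x ∈ C.set :=
  IsAdmissibleClosed.subset_iff D.prop.2.1 C.prop

theorem m_mem_set (C : ClosedUpsets X) : X.m ∈ C.set := by
  by_contra hm
  obtain ⟨y, hy, -, hmy⟩ := C.prop.exists_le hm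
  exact X.X₀_subset hy (le_antisymm (X.le_m y) hmy)

theorem set_top : (⊤ : ClosedUpsets X).set = {X.m} := by
  refine Set.Subset.antisymm (fun x hx => ?_) (Set.singleton_subset_iff.2 (m_mem_set _))
  have : (ClosedUpsets.mk (Set.Ici X.m) (isAdmissibleClosed_Ici X.m)) ≤ ⊤ := le_top
  exact le_antisymm (X.le_m x) (this hx)

instance : Order.Frame (ClosedUpsets X) :=
  Order.Frame.ofMinimalAxioms
    { inf_sSup_le_iSup_inf := fun C S => by
        rw [le_iff_X₀]
        intro x hx h
        rw [mem_set_inf hx, or_iff_not_imp_left]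
        intro hxC
        rw [set_sSup]
        rintro _ ⟨D, hD, rfl⟩
        have : C ⊓ D ≤ ⨆ b ∈ S, C ⊓ b := le_iSup₂_of_le D hD le_rfl
        exact ((mem_set_inf hx).1 (this h)).resolve_left hxC }

/-- Directed joins are filtered intersections of closed sets, so this is topological compactness; it
makes clopen elements compact in the frame. -/
theorem exists_mem_subset_of_sSup_subset {S : Set (ClosedUpsets X)} (hne : S.Nonempty)
    (hdir : DirectedOn (· ≤ ·) S) {O : Set X} (hO : IsOpen O) (hS : (sSup S).set ⊆ O) :
    ∃ D ∈ S, D.set ⊆ O := by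
  by_contra! hno
  obtain ⟨x, hx⟩ := IsCompact.nonempty_sInter_of_directed_nonempty_isCompact_isClosed
    (hS := (hne.image fun D : ClosedUpsets X => D.set \ O).to_subtype)
    (by
      rintro _ ⟨D, hD, rfl⟩ _ ⟨E, hE, rfl⟩
      obtain ⟨F, hF, hDF, hEF⟩ := hdir D hD E hE
      exact ⟨_, ⟨F, hF, rfl⟩, Set.sdiff_subset_sdiff_left hDF, Set.sdiff_subset_sdiff_left hEF⟩)
    (by
      rintro _ ⟨D, hD, rfl⟩
      exact Set.nonempty_of_not_subset (hno D hD))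
    (by
      rintro _ ⟨D, hD, rfl⟩
      exact (D.prop.1.sdiff hO).isCompact)
    (by
      rintro _ ⟨D, hD, rfl⟩
      exact D.prop.1.sdiff hO)
  refine (hx _ ⟨hne.some, hne.some_mem, rfl⟩).2 (hS ?_)
  rw [set_sSup]
  rintro _ ⟨D, hD, rfl⟩
  exact (hx _ ⟨D, hD, rfl⟩).1

theorem isCompactElement_of_isAdmissibleClopen {C : ClosedUpsets X}
    (hC : IsAdmissibleClopen X.X₀ C.set) : IsCompactElement C := by
  rw [CompleteLattice.isCompactElement_iff_le_of_directed_sSup_le]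
  exact fun S hne hdir hle => exists_mem_subset_of_sSup_subset hne hdir hC.1.2 hle

/-- The admissible clopen upsets containing `C`, as elements of the frame. -/
def clopens (C : ClosedUpsets X) : Set (ClosedUpsets X) :=
  {D | IsAdmissibleClopen X.X₀ D.set ∧ D ≤ C}

theorem sSup_clopens (C : ClosedUpsets X) : sSup C.clopens = C := by
  refine le_antisymm (sSup_le fun D hD => hD.2) ?_
  rw [le_iff, set_sSup]
  conv_rhs => rw [isAdmissibleClosed_eq_sInter C.prop]
  rintro x hx U ⟨hU, hCU⟩
  exact hx U ⟨ClosedUpsets.mk U (isAdmissibleClopen_iff.1 hU).1, ⟨hU, hCU⟩, rfl⟩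

theorem directedOn_clopens (C : ClosedUpsets X) : DirectedOn (· ≤ ·) C.clopens :=
  fun D hD E hE => ⟨ClosedUpsets.mk (D.set ∩ E.set) (D.prop.inter E.prop),
    ⟨hD.1.inter hE.1, Set.subset_inter hD.2 hE.2⟩, Set.inter_subset_left, Set.inter_subset_right⟩

theorem nonempty_clopens (C : ClosedUpsets X) : C.clopens.Nonempty := by
  have : IsAdmissibleClopen X.X₀ Set.univ :=
    ⟨isClopen_univ, isUpperSet_univ, fun x hx => absurd trivial hx.1⟩
  exact ⟨ClosedUpsets.mk Set.univ (isAdmissibleClopen_iff.1 this).1, this, Set.subset_univ _⟩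

/-- Every element is a directed join of admissible clopen ones, so a compact element equals one of
them. -/
theorem isCompactElement_iff {C : ClosedUpsets X} :
    IsCompactElement C ↔ IsAdmissibleClopen X.X₀ C.set := by
  refine ⟨fun h => ?_, isCompactElement_of_isAdmissibleClopen⟩
  obtain ⟨D, hD, hCD⟩ := h.exists_le_of_le_sSup C.nonempty_clopens C.directedOn_clopens
    C.sSup_clopens.ge
  rw [le_antisymm hCD hD.2]
  exact hD.1

instance : IsCompactlyGenerated (ClosedUpsets X) :=
  ⟨fun C => ⟨C.clopens, fun _ hD => isCompactElement_of_isAdmissibleClopen hD.1, C.sSup_clopens⟩⟩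

/-! ### Points of `X` as pseudoprimes of the frame -/

/-- The principal upset of a point. -/
def point (x : X) : ClosedUpsets X := ClosedUpsets.mk (Set.Ici x) (isAdmissibleClosed_Ici x)

theorem le_point_iff {C : ClosedUpsets X} {x : X} : C ≤ point x ↔ x ∈ C.set :=
  ⟨fun h => h (Set.mem_Ici.2 le_rfl), fun h _ hy => C.prop.2.1 hy h⟩

theorem point_le_point_iff {x y : X} : point x ≤ point y ↔ x ≤ y := le_point_iff

/-- If `x` lies in `k` but in no member of `S`, density gives `y ∈ X₀` with the same property.
Directedness at `y` puts all members of `S` inside one admissible `U` missing `y`; but `S.inf id ≤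
k` then forces `k ⊆ U`, a contradiction. -/
theorem point_mem_YPoints (x : X) : IsPseudoprime (point x) ∨ point x = ⊤ := by
  refine isPseudoprime_or_eq_top_iff.2 fun S hS hc k hk hSk hkx => ?_
  simp only [le_point_iff] at hkx ⊢
  by_contra! hno
  have hxm : x ≠ X.m := by
    rintro rfl
    exact hno _ hS.choose_spec (m_mem_set _)
  have hopen : IsOpen (k.set ∩ ⋂ s ∈ S, s.setᶜ) :=
    (isCompactElement_iff.1 hk).1.2.inter
      (isOpen_biInter_finset fun s hs => (isCompactElement_iff.1 (hc s hs)).1.compl.2)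
  obtain ⟨y, ⟨hyk, hyS⟩, hy⟩ := mem_closure_iff.1 (X.X₀_dense hxm) _ hopen
    ⟨hkx, Set.mem_iInter₂.2 hno⟩
  obtain ⟨U, hU, hyU, hSU⟩ := exists_superset_of_finite hy (S := ClosedUpsets.set '' (S : Set _))
    (S.finite_toSet.image _) (by
      rintro _ ⟨s, hs, rfl⟩
      exact ⟨isCompactElement_iff.1 (hc s hs), Set.mem_iInter₂.1 hyS s hs⟩)
  have hUS : ClosedUpsets.mk U (isAdmissibleClopen_iff.1 hU).1 ≤ S.inf id :=
    Finset.le_inf fun s hs => (Set.subset_sUnion_of_mem (Set.mem_image_of_mem ClosedUpsets.set hs)).trans hSU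
  exact hyU ((hUS.trans hSk) hyk)

theorem exists_eq_point {C : ClosedUpsets X} (hC : IsPseudoprime C ∨ C = ⊤) :
    ∃ x, C = point x := by
  classical
  -- Such an `x` is a least element of `C`. If there were none, finitely many bad sets `U x` would
  -- cover `C`, and pseudoprimality would put one of them below `C`.
  obtain ⟨x, hxC, hx⟩ : ∃ x ∈ C.set, ∀ U : ClosedUpsets X, IsCompactElement U → x ∈ U.set →
      U ≤ C := by
    by_contra! hno
    choose! U hU hxU hUC using hno
    obtain ⟨t, htC, hcover⟩ := C.prop.1.isCompact.elim_nhds_subcover (fun x => (U x).set)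
      fun x hx => (isCompactElement_iff.1 (hU x hx)).1.2.mem_nhds (hxU x hx)
    have hne : t.Nonempty := by
      obtain ⟨y, hy, -⟩ := Set.mem_iUnion₂.1 (hcover C.m_mem_set)
      exact ⟨y, hy⟩
    -- A clopen `D` between `C` and the cover is the compact element that the criterion requires.
    obtain ⟨D, ⟨hD, hDC⟩, hDsub⟩ := exists_mem_subset_of_sSup_subset C.nonempty_clopens
      C.directedOn_clopens (isOpen_biUnion fun x hx =>
        (isCompactElement_iff.1 (hU x (htC x hx))).1.2) (C.sSup_clopens.symm ▸ hcover)
    have hinf : (t.image U).inf id ≤ D := by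
      rw [le_iff_X₀]
      intro y _ hyD
      obtain ⟨z, hz, hyz⟩ := Set.mem_iUnion₂.1 (hDsub hyD)
      exact (Finset.inf_le (f := id) (Finset.mem_image_of_mem U hz) : _ ≤ U z) hyz
    obtain ⟨V, hV, hVC⟩ := isPseudoprime_or_eq_top_iff.1 hC (t.image U) (hne.image U)
      (by simpa using fun x hx => hU x (htC x hx)) D (isCompactElement_iff.2 hD) hinf hDC
    obtain ⟨x, hx, rfl⟩ := Finset.mem_image.1 hV
    exact hUC x (htC x hx) hVC
  refine ⟨x, le_antisymm (le_point_iff.2 hxC) (le_iff_compact_le_imp.2 fun U hU h => ?_)⟩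
  exact hx U hU (le_point_iff.1 h)

theorem infPrime_point_iff {x : X} : InfPrime (point x) ↔ x ∈ X.X₀ := by
  have htop : point x = ⊤ ↔ x = X.m := by
    rw [← top_le_iff, le_point_iff, set_top, Set.mem_singleton_iff]
  constructor
  · intro h
    refine (X.mem_X₀_iff x).2 ⟨?_, ?_⟩
    · obtain ⟨y, hy, hxy⟩ := X.X₀_orderDense x fun hx => h.ne_top (htop.2 hx)
      obtain ⟨U, hU, hyU⟩ := ((X.mem_X₀_iff y).1 hy).1
      exact ⟨U, hU, fun hxU => hyU (hU.2.1 hxy hxU)⟩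
    · rintro U ⟨hU, hxU⟩ V ⟨hV, hxV⟩
      have hUV : ¬ ClosedUpsets.mk U (isAdmissibleClopen_iff.1 hU).1 ⊓
          ClosedUpsets.mk V (isAdmissibleClopen_iff.1 hV).1 ≤ point x := fun hle =>
        (h.2 hle).elim (fun h' => hxU (le_point_iff.1 h')) fun h' => hxV (le_point_iff.1 h')
      obtain ⟨W, hW, hWUV, hWx⟩ := exists_compact_le_not_le hUV
      exact ⟨W.set, ⟨isCompactElement_iff.1 hW, fun hx => hWx (le_point_iff.2 hx)⟩,
        hWUV.trans inf_le_left, hWUV.trans inf_le_right⟩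
  · intro hx
    refine ⟨fun hmax => X.X₀_subset hx (htop.1 (top_le_iff.1 (hmax le_top))), fun C D h => ?_⟩
    rw [le_point_iff, mem_set_inf hx] at h
    exact h.imp le_point_iff.2 le_point_iff.2

/-! ### Preimages -/

variable {Y : PGPSP.{u}}

/-- Strong Priestley morphisms control only clopen sets, so the closed set is first written as an
intersection of admissible clopen ones. -/
theorem isAdmissibleClosed_preimage {f : X → Y} (hf : IsStrongPriestley X.X₀ Y.X₀ f)
    (C : ClosedUpsets Y) : IsAdmissibleClosed X.X₀ (f ⁻¹' C.set) := by
  rw [isAdmissibleClosed_eq_sInter C.prop, Set.preimage_sInter, ← Set.sInter_image]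
  refine IsAdmissibleClosed.sInter ?_
  rintro _ ⟨U, hU, rfl⟩
  exact (isAdmissibleClopen_iff.1 (hf.2 U hU.1)).1

/-- The preimage map as a frame homomorphism. -/
def comap (f : X → Y) (hf : IsStrongPriestley X.X₀ Y.X₀ f) (hf₀ : Set.MapsTo f X.X₀ Y.X₀) :
    FrameHom (ClosedUpsets Y) (ClosedUpsets X) where
  toFun C := ClosedUpsets.mk (f ⁻¹' C.set) (isAdmissibleClosed_preimage hf C)
  map_inf' C D := by
    refine le_antisymm (le_iff_X₀.2 fun x hx h => ?_) (le_iff_X₀.2 fun x hx h => ?_)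
    -- Meets are unions only on the distinguished sets, which is why `f` must map `X₀` into `Y₀`.
    · exact (mem_set_inf (hf₀ hx)).2 ((mem_set_inf hx).1 h)
    · exact (mem_set_inf hx).2 ((mem_set_inf (hf₀ hx)).1 h)
  map_top' := by
    refine top_le_iff.1 (le_iff_X₀.2 fun x hx h => ?_)
    have : f x ∈ (⊤ : ClosedUpsets Y).set := h
    rw [set_top] at this
    exact absurd this (Y.X₀_subset (hf₀ hx))
  map_sSup' S := ClosedUpsets.ext (by
    refine Set.ext fun x => ⟨fun h => ?_, fun h => ?_⟩
    · rintro _ ⟨_, ⟨D, hD, rfl⟩, rfl⟩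
      exact h _ ⟨D, hD, rfl⟩
    · rintro _ ⟨D, hD, rfl⟩
      exact h _ ⟨_, ⟨D, hD, rfl⟩, rfl⟩)

theorem isCompactElement_comap (f : X → Y) (hf : IsStrongPriestley X.X₀ Y.X₀ f)
    (hf₀ : Set.MapsTo f X.X₀ Y.X₀) {C : ClosedUpsets Y} (hC : IsCompactElement C) :
    IsCompactElement (comap f hf hf₀ C) :=
  isCompactElement_iff.2 (hf.2 _ (isCompactElement_iff.1 hC))

theorem rightAdjoint_comap_point (f : X → Y) (hf : IsStrongPriestley X.X₀ Y.X₀ f)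
    (hf₀ : Set.MapsTo f X.X₀ Y.X₀) (x : X) :
    rightAdjoint (comap f hf hf₀) (point x) = point (f x) :=
  eq_of_forall_le_iff fun C => by
    rw [le_rightAdjoint_frameHom_iff, le_point_iff, le_point_iff]
    rfl

end ClosedUpsets

end PGPSP

/-! ### The frame of filters of a distributive meet-semilattice -/

section FilterLattice

variable {M : Type u} [SemilatticeInf M]

namespace Order.PFilter

theorem directedOn_principal (F : PFilter M) : DirectedOn (· ≤ ·) (principal '' (F : Set M)) := by
  rintro _ ⟨x, hx, rfl⟩ _ ⟨y, hy, rfl⟩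
  exact ⟨_, ⟨x ⊓ y, inf_mem hx hy, rfl⟩, antitone_principal inf_le_left,
    antitone_principal inf_le_right⟩

variable [OrderTop M]

/-- Build a filter from a set containing the top element, closed under meets and upwards. -/
def ofSet (s : Set M) (ht : ⊤ ∈ s) (hi : ∀ x ∈ s, ∀ y ∈ s, x ⊓ y ∈ s)
    (hu : ∀ x y, x ≤ y → x ∈ s → y ∈ s) : PFilter M :=
  (IsPFilter.of_def ⟨⊤, ht⟩ (fun x hx y hy => ⟨x ⊓ y, hi x hx y hy, inf_le_left, inf_le_right⟩)
    (fun {x y} => hu x y)).toPFilter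

instance : InfSet (PFilter M) :=
  ⟨fun S => ofSet {x | ∀ F ∈ S, x ∈ F} (fun _ _ => top_mem)
    (fun _ hx _ hy F hF => inf_mem (hx F hF) (hy F hF))
    (fun _ _ hxy hx F hF => mem_of_le hxy (hx F hF))⟩

instance : CompleteLattice (PFilter M) :=
  completeLatticeOfInf (PFilter M) fun _ =>
    ⟨fun F hF _ hx => hx F hF, fun _ hG _ hx _ hF => hG hF hx⟩

theorem mem_inf {F G : PFilter M} {x : M} : x ∈ F ⊓ G ↔ x ∈ F ∧ x ∈ G := by
  simp only [← principal_le_iff, le_inf_iff]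

theorem mem_top {x : M} : x ∈ (⊤ : PFilter M) := principal_le_iff.1 le_top

theorem eq_top_iff_coe {F : PFilter M} : F = ⊤ ↔ (F : Set M) = Set.univ := by
  rw [← top_le_iff, Set.eq_univ_iff_forall]
  exact ⟨fun h x => h mem_top, fun h x _ => h x⟩

theorem sSup_principal (F : PFilter M) : sSup (principal '' (F : Set M)) = F :=
  le_antisymm (sSup_le (by rintro _ ⟨x, hx, rfl⟩; exact principal_le_iff.2 hx))
    fun _ hx => principal_le_iff.1 (le_sSup ⟨_, hx, rfl⟩)

/-- The union of a directed family of filters. -/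
def directedUnion (S : Set (PFilter M)) (hne : S.Nonempty) (hdir : DirectedOn (· ≤ ·) S) :
    PFilter M :=
  ofSet {x | ∃ F ∈ S, x ∈ F} ⟨_, hne.some_mem, top_mem⟩
    (fun _ ⟨F, hF, hx⟩ _ ⟨G, hG, hy⟩ => by
      obtain ⟨H, hH, hFH, hGH⟩ := hdir F hF G hG
      exact ⟨H, hH, inf_mem (hFH hx) (hGH hy)⟩)
    (fun _ _ hxy ⟨F, hF, hx⟩ => ⟨F, hF, mem_of_le hxy hx⟩)

/-- A directed union of filters is already a filter, so `a` belongs to a single member. -/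
theorem isCompactElement_principal (a : M) : IsCompactElement (principal a) := by
  rw [CompleteLattice.isCompactElement_iff_le_of_directed_sSup_le]
  intro S hne hdir h
  have : sSup S ≤ directedUnion S hne hdir := sSup_le fun F hF x hx => ⟨F, hF, hx⟩
  obtain ⟨F, hF, ha⟩ := this (principal_le_iff.1 h)
  exact ⟨F, hF, principal_le_iff.2 ha⟩

theorem isCompactElement_iff {F : PFilter M} : IsCompactElement F ↔ ∃ a, F = principal a := by
  refine ⟨fun h => ?_, by rintro ⟨a, rfl⟩; exact isCompactElement_principal a⟩
  obtain ⟨_, ⟨a, ha, rfl⟩, hFa⟩ := h.exists_le_of_le_sSup (F.nonempty.image principal)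
    F.directedOn_principal F.sSup_principal.ge
  exact ⟨a, le_antisymm hFa (principal_le_iff.2 ha)⟩

instance : IsCompactlyGenerated (PFilter M) :=
  ⟨fun F => ⟨_, by rintro _ ⟨x, -, rfl⟩; exact isCompactElement_principal x, F.sSup_principal⟩⟩

end Order.PFilter

end FilterLattice

open Order (PFilter)
open Order.PFilter

/-- The Heyting implication of filters. -/
def DMSP.filterHimp (M : DMSP.{u}) (F G : PFilter M) : PFilter M :=
  ofSet {x | ∀ y, x ≤ y → y ∈ F → y ∈ G}
    (fun y hy _ => top_le_iff.1 hy ▸ top_mem)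
    (fun x hx x' hx' y hy hyF => by
      -- Distributivity of the semilattice enters here: it splits `y` into a part above `x` and a
      -- part above `x'`.
      obtain ⟨a, b, hxa, hxb, rfl⟩ := M.distrib x x' y hy
      exact inf_mem (hx a hxa (mem_of_le inf_le_left hyF)) (hx' b hxb (mem_of_le inf_le_right hyF)))
    (fun _ _ hxx' hx y hy => hx y (hxx'.trans hy))

theorem DMSP.le_filterHimp_iff (M : DMSP.{u}) (F G H : PFilter M) :
    F ≤ M.filterHimp G H ↔ F ⊓ G ≤ H :=
  ⟨fun h x hx => h (mem_inf.1 hx).1 x le_rfl (mem_inf.1 hx).2,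
    fun h _ hx _ hxy hy => h (mem_inf.2 ⟨mem_of_le hxy hx, hy⟩)⟩

instance DMSP.frame (M : DMSP.{u}) : Order.Frame (PFilter M) :=
  Order.Frame.ofMinimalAxioms
    { inf_sSup_le_iSup_inf := fun F S => by
        rw [inf_comm, ← M.le_filterHimp_iff]
        refine sSup_le fun G hG => ?_
        rw [M.le_filterHimp_iff, inf_comm]
        exact le_iSup₂_of_le G hG le_rfl }

/-- The algebraic frame of filters. -/
def DMSP.filterFrame (M : DMSP.{u}) : AlgFrm.{u} where
  carrier := PFilter M

namespace DMSP

variable {M N : DMSP.{u}}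

/-- The filter generated by the image of a filter. -/
def mapFilter (α : InfTopHom M N) (F : PFilter M) : PFilter N :=
  ofSet {y | ∃ x ∈ F, α x ≤ y} ⟨⊤, top_mem, le_top⟩
    (fun _ ⟨x, hx, hxy⟩ _ ⟨x', hx', hxy'⟩ =>
      ⟨x ⊓ x', inf_mem hx hx', by rw [map_inf]; exact inf_le_inf hxy hxy'⟩)
    (fun _ _ hyz ⟨x, hx, hxy⟩ => ⟨x, hx, hxy.trans hyz⟩)

/-- The preimage of a filter. -/
def comapFilter (α : InfTopHom M N) (G : PFilter N) : PFilter M :=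
  ofSet {x | α x ∈ G} (by simp) (fun x hx y hy => by
    rw [Set.mem_ofPred_eq, map_inf]
    exact inf_mem hx hy) (fun _ _ hxy hx => mem_of_le (OrderHomClass.mono α hxy) hx)

theorem mapFilter_gc (α : InfTopHom M N) : GaloisConnection (mapFilter α) (comapFilter α) :=
  fun _ _ => ⟨fun h x hx => h ⟨x, hx, le_rfl⟩, fun h _ ⟨_, hx, hxy⟩ => mem_of_le hxy (h hx)⟩

theorem mapFilter_principal (α : InfTopHom M N) (a : M) :
    mapFilter α (principal a) = principal (α a) :=
  le_antisymm ((mapFilter_gc α _ _).2 (principal_le_iff.2 (mem_principal.2 le_rfl)))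
    (principal_le_iff.2 ⟨a, mem_principal.2 le_rfl, le_rfl⟩)

theorem mapFilter_id (F : PFilter M) : mapFilter (InfTopHom.id M) F = F :=
  PFilter.ext _ _ <| Set.ext fun x => ⟨fun ⟨_, hy, hyx⟩ => mem_of_le hyx hy, fun hx => ⟨x, hx, le_rfl⟩⟩

theorem mapFilter_comp {K : DMSP.{u}} (α : InfTopHom M N) (β : InfTopHom N K) (F : PFilter M) :
    mapFilter (β.comp α) F = mapFilter β (mapFilter α F) :=
  PFilter.ext _ _ <| Set.ext fun _ => ⟨fun ⟨x, hx, hxz⟩ => ⟨_, ⟨x, hx, le_rfl⟩, hxz⟩,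
    fun ⟨_, ⟨x, hx, hxy⟩, hyz⟩ => ⟨x, hx, (OrderHomClass.mono β hxy).trans hyz⟩⟩

/-- The frame homomorphism induced by a morphism of distributive meet-semilattices. -/
def mapFilterHom (α : Hom M N) : FrameHom (PFilter M) (PFilter N) where
  toFun := mapFilter α.toInfTopHom
  map_inf' F G := by
    refine le_antisymm ((mapFilter_gc _).monotone_l.map_inf_le F G) fun y hy => ?_
    obtain ⟨⟨x, hx, hxy⟩, ⟨x', hx', hxy'⟩⟩ := mem_inf.1 hy
    -- The upper bound condition for pairs yields binary meets of filters; for the empty set it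
    -- yields the top filter below.
    obtain ⟨c, hc, hcy⟩ := α.lift_upperBound {x, x'} (Set.toFinite _) y (by
      rintro _ ⟨z, rfl | rfl, rfl⟩ <;> assumption)
    exact ⟨c, mem_inf.2 ⟨mem_of_le (hc (by simp)) hx, mem_of_le (hc (by simp)) hx'⟩, hcy⟩
  map_top' := top_le_iff.1 fun y _ => by
    obtain ⟨c, -, hc⟩ := α.lift_upperBound ∅ Set.finite_empty y (by simp)
    exact ⟨c, mem_top, hc⟩
  map_sSup' S := (mapFilter_gc _).l_sSup.trans sSup_image.symm

theorem isCompactElement_mapFilterHom (α : Hom M N) (F : PFilter M) (hF : IsCompactElement F) :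
    IsCompactElement (mapFilterHom α F) := by
  obtain ⟨a, rfl⟩ := Order.PFilter.isCompactElement_iff.1 hF
  exact Order.PFilter.isCompactElement_iff.2 ⟨_, mapFilter_principal _ a⟩

/-- The morphism of filter frames induced by a morphism of semilattices. -/
def mapFilterFrame (α : Hom M N) : AlgFrm.Hom M.filterFrame N.filterFrame :=
  ⟨mapFilterHom α, isCompactElement_mapFilterHom α⟩

end DMSP

/-- The functor sending a distributive meet-semilattice to its frame of filters. -/
def filterFunctor : DMSP.{u} ⥤ AlgFrm.{u} where
  obj M := M.filterFrame
  map α := DMSP.mapFilterFrame α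
  map_id _ := AlgFrm.Hom.ext (FrameHom.ext DMSP.mapFilter_id)
  map_comp α β := AlgFrm.Hom.ext (FrameHom.ext
    (DMSP.mapFilter_comp (DMSP.Hom.toInfTopHom α) (DMSP.Hom.toInfTopHom β)))

/-! ### The semilattice of compact elements -/

/-- Preserving finite meets gives `k ≤ f (⋀ S)`, and compactness of `k` replaces the meet by a
compact element below it. In the dual order this is the upper bound condition on semilattice
morphisms. -/
theorem exists_compact_lowerBound {L L' : Type u} [Order.Frame L] [IsCompactlyGenerated L]
    [Order.Frame L'] (f : FrameHom L L') {S : Set L} (hS : S.Finite) {k : L'}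
    (hk : IsCompactElement k) (h : ∀ s ∈ S, k ≤ f s) :
    ∃ c : L, IsCompactElement c ∧ (∀ s ∈ S, c ≤ s) ∧ k ≤ f c := by
  have hk' : k ≤ f (hS.toFinset.inf id) := by
    rw [map_finset_inf]
    exact Finset.le_inf fun s hs => h s (hS.mem_toFinset.1 hs)
  obtain ⟨c, hc, hcS, hkc⟩ := exists_compact_le_map (map_sSup f) (OrderHomClass.mono f) hk hk'
  exact ⟨c, hc, fun s hs => hcS.trans (Finset.inf_le (f := id) (hS.mem_toFinset.2 hs)), hkc⟩

namespace AlgFrm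

/-- The compact elements, with the dual order. -/
abbrev Compacts (L : AlgFrm.{u}) : Type u := {k : L // IsCompactElement k}ᵒᵈ

namespace Compacts

variable {L : AlgFrm.{u}}

/-- The underlying element of the frame. -/
def val (k : Compacts L) : L := (ofDual k).1

theorem isCompact (k : Compacts L) : IsCompactElement k.val := (ofDual k).2

/-- A compact element as an element of the semilattice of compact elements. -/
def mk (k : L) (hk : IsCompactElement k) : Compacts L := toDual ⟨k, hk⟩

theorem le_iff {k l : Compacts L} : k ≤ l ↔ l.val ≤ k.val := Iff.rfl

theorem ext {k l : Compacts L} (h : k.val = l.val) : k = l := congrArg toDual (Subtype.ext h)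

instance : SemilatticeInf (Compacts L) where
  inf k l := mk (k.val ⊔ l.val) (k.isCompact.sup l.isCompact)
  inf_le_left k _ := le_sup_left (a := k.val)
  inf_le_right k _ := le_sup_right (a := k.val)
  le_inf _ _ _ hl hm := sup_le (α := L) hl hm

instance : OrderTop (Compacts L) where
  top := mk ⊥ isCompact_bot_element
  le_top k := bot_le (a := k.val)

end Compacts

/-- The distributive meet-semilattice of compact elements. -/
def compactDMSP (L : AlgFrm.{u}) : DMSP.{u} where
  carrier := Compacts L
  distrib a b c h := by
    -- In the frame order `h` reads `c ≤ a ⊔ b`. Frame distributivity splits `c`, and its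
    -- compactness replaces the two parts by compact elements.
    have h' : c.val ≤ (c.val ⊓ a.val) ⊔ (c.val ⊓ b.val) := by
      rw [← inf_sup_left]
      exact le_inf le_rfl h
    set S : Set L := Set.image2 (· ⊔ ·) {k | IsCompactElement k ∧ k ≤ c.val ⊓ a.val}
      {k | IsCompactElement k ∧ k ≤ c.val ⊓ b.val}
    have hle : (c.val ⊓ a.val) ⊔ (c.val ⊓ b.val) ≤ sSup S := by
      refine sup_le (le_iff_compact_le_imp.2 fun k hk hka => le_sSup ?_)
        (le_iff_compact_le_imp.2 fun k hk hkb => le_sSup ?_)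
      · exact ⟨k, ⟨hk, hka⟩, ⊥, ⟨isCompact_bot_element, bot_le⟩, sup_bot_eq k⟩
      · exact ⟨⊥, ⟨isCompact_bot_element, bot_le⟩, k, ⟨hk, hkb⟩, bot_sup_eq k⟩
    obtain ⟨_, ⟨k, hk, l, hl, rfl⟩, hc⟩ := c.isCompact.exists_le_of_le_sSup
      ((nonempty_compact_le _).image2 (nonempty_compact_le _))
      (by
        rintro _ ⟨k, hk, l, hl, rfl⟩ _ ⟨k', hk', l', hl', rfl⟩
        exact ⟨_, ⟨k ⊔ k', ⟨hk.1.sup hk'.1, sup_le hk.2 hk'.2⟩, l ⊔ l',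
          ⟨hl.1.sup hl'.1, sup_le hl.2 hl'.2⟩, rfl⟩,
          sup_le_sup le_sup_left le_sup_left, sup_le_sup le_sup_right le_sup_right⟩)
      (h'.trans hle)
    refine ⟨Compacts.mk k hk.1, Compacts.mk l hl.1, hk.2.trans inf_le_right,
      hl.2.trans inf_le_right, Compacts.ext (le_antisymm ?_ hc)⟩
    exact sup_le (hk.2.trans inf_le_left) (hl.2.trans inf_le_left)

variable {L L' : AlgFrm.{u}}

/-- The restriction of a morphism to compact elements. -/
def compactMap (f : Hom L L') : DMSP.Hom L.compactDMSP L'.compactDMSP where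
  toInfTopHom :=
    { toFun := fun k : Compacts L => (Compacts.mk (f.toFrameHom k.val)
        (f.map_compact _ k.isCompact) : Compacts L')
      map_inf' := fun k l => Compacts.ext (map_sup f.toFrameHom (Compacts.val k) (Compacts.val l))
      map_top' := Compacts.ext (map_bot f.toFrameHom) }
  lift_upperBound S hS x hx := by
    obtain ⟨c, hc, hcS, hxc⟩ := exists_compact_lowerBound f.toFrameHom
      (hS.image (Compacts.val (L := L))) (Compacts.isCompact x) (by
        rintro _ ⟨s, hs, rfl⟩
        exact hx ⟨s, hs, rfl⟩)
    exact ⟨Compacts.mk c hc, fun s hs => hcS _ ⟨s, hs, rfl⟩, hxc⟩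

end AlgFrm

/-- The functor sending an algebraic frame to its semilattice of compact elements. -/
def compactFunctor : AlgFrm.{u} ⥤ DMSP.{u} where
  obj L := L.compactDMSP
  map f := AlgFrm.compactMap f
  map_id _ := rfl
  map_comp _ _ := rfl

/-! ### The equivalence between semilattices and frames -/

theorem IsCompactElement.map_orderIso {L L' : Type u} [CompleteLattice L] [CompleteLattice L']
    (e : L ≃o L') {k : L} (hk : IsCompactElement k) : IsCompactElement (e k) := by
  rw [CompleteLattice.isCompactElement_iff_le_of_directed_sSup_le]
  intro S hne hdir h
  rw [← e.le_symm_apply, map_sSup] at h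
  obtain ⟨_, ⟨x, hx, rfl⟩, hkx⟩ := hk.exists_le_of_le_sSup (hne.image e.symm)
    (hdir.mono_comp fun _ _ h => e.symm.monotone h) h
  exact ⟨x, hx, e.le_symm_apply.1 hkx⟩

/-- Order isomorphisms of algebraic frames are isomorphisms. -/
def AlgFrm.isoMk {L L' : AlgFrm.{u}} (e : L ≃o L') : L ≅ L' where
  hom := (⟨⟨⟨⟨e, map_inf e⟩, map_top e⟩, map_sSup e⟩, fun _ hk =>
    hk.map_orderIso e⟩ : AlgFrm.Hom L L')
  inv := (⟨⟨⟨⟨e.symm, map_inf e.symm⟩, map_top e.symm⟩, map_sSup e.symm⟩, fun _ hk =>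
    hk.map_orderIso e.symm⟩ : AlgFrm.Hom L' L)
  hom_inv_id := AlgFrm.Hom.ext (FrameHom.ext e.symm_apply_apply)
  inv_hom_id := AlgFrm.Hom.ext (FrameHom.ext e.apply_symm_apply)

/-- Order isomorphisms of distributive meet-semilattices are isomorphisms. -/
def DMSP.isoMk {M N : DMSP.{u}} (e : M ≃o N) : M ≅ N where
  hom := (⟨⟨⟨e, map_inf e⟩, map_top e⟩, fun _ _ x hx =>
    ⟨e.symm x, fun s hs => e.le_symm_apply.2 (hx ⟨s, hs, rfl⟩),
      (e.apply_symm_apply x).le⟩⟩ : DMSP.Hom M N)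
  inv := (⟨⟨⟨e.symm, map_inf e.symm⟩, map_top e.symm⟩, fun _ _ x hx =>
    ⟨e x, fun s hs => e.symm_apply_le.1 (hx ⟨s, hs, rfl⟩),
      (e.symm_apply_apply x).le⟩⟩ : DMSP.Hom N M)
  hom_inv_id := DMSP.Hom.ext (InfTopHom.ext e.symm_apply_apply)
  inv_hom_id := DMSP.Hom.ext (InfTopHom.ext e.apply_symm_apply)

/-- A surjective order embedding as an order isomorphism. -/
noncomputable def orderIsoOfLeIff {P Q : Type u} [PartialOrder P] [Preorder Q] (f : P → Q)
    (h : ∀ a b, f a ≤ f b ↔ a ≤ b) (hs : Function.Surjective f) : P ≃o Q :=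
  RelIso.ofSurjective (OrderEmbedding.ofMapLEIff f h) hs

/-- A distributive meet-semilattice is isomorphic to the compact elements of its filter frame. -/
noncomputable def DMSP.unitEquiv (M : DMSP.{u}) : M ≃o M.filterFrame.compactDMSP :=
  orderIsoOfLeIff (Q := AlgFrm.Compacts M.filterFrame)
    (fun a => AlgFrm.Compacts.mk (L := M.filterFrame) (principal a) (isCompactElement_principal a))
    (fun _ _ => principal_le_principal_iff)
    (fun k => by
      obtain ⟨a, ha⟩ := Order.PFilter.isCompactElement_iff.1 (AlgFrm.Compacts.isCompact k)
      exact ⟨a, AlgFrm.Compacts.ext ha.symm⟩)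

/-! ### Recovering an algebraic frame from its compact elements. -/

namespace AlgFrm

variable {L : AlgFrm.{u}}

/-- The filter of compact elements below `a`. -/
def compactsBelow (a : L) : PFilter L.compactDMSP :=
  ofSet {k : Compacts L | k.val ≤ a} (bot_le (a := a))
    (fun _ hx _ hy => sup_le (α := L) hx hy) (fun _ _ hxy hx => le_trans (α := L) hxy hx)

theorem compactsBelow_le_iff {a b : L} : compactsBelow a ≤ compactsBelow b ↔ a ≤ b :=
  ⟨fun h => le_iff_compact_le_imp.2 fun k hk hka => h (x := Compacts.mk k hk) hka,
    fun h _ hk => le_trans (α := L) hk h⟩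

theorem compactsBelow_surjective : Function.Surjective (compactsBelow (L := L)) := by
  intro F
  set S : Set L := Compacts.val '' (show Set (Compacts L) from (F : Set L.compactDMSP))
  have hdir : DirectedOn (· ≤ ·) S := by
    rintro _ ⟨k, hk, rfl⟩ _ ⟨l, hl, rfl⟩
    exact ⟨_, ⟨k ⊓ l, inf_mem hk hl, rfl⟩, le_sup_left (α := L), le_sup_right (α := L)⟩
  refine ⟨sSup S, SetLike.ext fun k => ⟨fun hk => ?_, fun hk => le_sSup ⟨k, hk, rfl⟩⟩⟩
  obtain ⟨_, ⟨l, hl, rfl⟩, hkl⟩ := (Compacts.isCompact k).exists_le_of_le_sSup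
    (s := S) (F.nonempty.image _) hdir hk
  exact mem_of_le (Compacts.le_iff.2 hkl) hl

/-- An algebraic frame is isomorphic to the filters of its compact elements. -/
noncomputable def counitEquiv (L : AlgFrm.{u}) : L ≃o L.compactDMSP.filterFrame :=
  orderIsoOfLeIff (Q := PFilter L.compactDMSP) compactsBelow (fun _ _ => compactsBelow_le_iff)
    compactsBelow_surjective

theorem mapFilter_compactsBelow {L' : AlgFrm.{u}} (f : Hom L L') (a : L) :
    DMSP.mapFilter (compactMap f).toInfTopHom (compactsBelow a) =
      compactsBelow (f.toFrameHom a) := by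
  refine SetLike.ext fun k => ⟨?_, fun hk => ?_⟩
  · rintro ⟨l, hl, hlk⟩
    exact (Compacts.le_iff.1 hlk).trans (OrderHomClass.mono f.toFrameHom hl)
  · obtain ⟨c, hc, hca, hkc⟩ := exists_compact_le_map (map_sSup f.toFrameHom)
      (OrderHomClass.mono f.toFrameHom) (Compacts.isCompact k) hk
    exact ⟨Compacts.mk c hc, hca, hkc⟩

end AlgFrm

/-- Filters and compact elements give an equivalence of categories. -/
noncomputable def filterEquivalence : DMSP.{u} ≌ AlgFrm.{u} :=
  CategoryTheory.Equivalence.mk filterFunctor compactFunctor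
    (NatIso.ofComponents (fun M => DMSP.isoMk M.unitEquiv) fun α =>
      DMSP.Hom.ext (InfTopHom.ext fun a => AlgFrm.Compacts.ext
        (DMSP.mapFilter_principal (DMSP.Hom.toInfTopHom α) a).symm))
    (Iso.symm <| NatIso.ofComponents (fun L => AlgFrm.isoMk L.counitEquiv) fun f =>
      AlgFrm.Hom.ext (FrameHom.ext fun a => (AlgFrm.mapFilter_compactsBelow f a).symm))

theorem isFilterFunctor_filterFunctor : IsFilterFunctor filterFunctor.{u} :=
  ⟨fun _ => OrderIso.refl _, fun _ _ _ _ => rfl⟩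

theorem isCompactElementsFunctor_compactFunctor : IsCompactElementsFunctor compactFunctor.{u} :=
  ⟨fun _ => OrderIso.refl _, fun _ _ _ _ => rfl⟩

/-! ### The duality between frames and spaces -/

theorem IsAdmissibleClopen.preimage_orderIso {X Y : Type u} [TopologicalSpace X] [PartialOrder X]
    [TopologicalSpace Y] [PartialOrder Y] {X₀ : Set X} {Y₀ : Set Y} (e : X ≃o Y)
    (he : Continuous e) (h₀ : ∀ x, e x ∈ Y₀ → x ∈ X₀) {U : Set Y}
    (hU : IsAdmissibleClopen Y₀ U) : IsAdmissibleClopen X₀ (e ⁻¹' U) := by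
  refine ⟨hU.1.preimage he, hU.2.1.preimage e.monotone, fun x hx => h₀ x (hU.2.2 ⟨hx.1, ?_⟩)⟩
  intro y hy hxy
  have := hx.2 (y := e.symm y) (by simpa using hy) (e.le_symm_apply.2 hxy)
  exact e.symm_apply_le.1 this

/-- Order isomorphisms that are homeomorphisms and match the distinguished dense sets are
isomorphisms of pointed generalized Priestley spaces. -/
def PGPSP.isoMk {X Y : PGPSP.{u}} (e : X ≃o Y) (he : IsHomeomorph e)
    (h₀ : ∀ x, e x ∈ Y.X₀ ↔ x ∈ X.X₀) : X ≅ Y where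
  hom := (⟨e, ⟨e.monotone, fun _ hU => hU.preimage_orderIso e he.continuous fun x => (h₀ x).1⟩,
    fun x => (h₀ x).2⟩ : PGPSP.Hom X Y)
  inv := (⟨e.symm, ⟨e.symm.monotone, fun _ hU => hU.preimage_orderIso e.symm
      (by
        have : ⇑(he.homeomorph e).symm = ⇑e.symm := by
          funext y
          rw [Homeomorph.symm_apply_eq]
          exact (e.apply_symm_apply y).symm
        exact this ▸ (he.homeomorph e).symm.continuous)
      fun y hy => by simpa using (h₀ _).2 hy⟩,
    fun y hy => (h₀ _).1 (by simpa using hy)⟩ : PGPSP.Hom Y X)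
  hom_inv_id := PGPSP.Hom.ext (funext e.symm_apply_apply)
  inv_hom_id := PGPSP.Hom.ext (funext e.apply_symm_apply)

/-- The morphism of spaces induced by a morphism of algebraic frames. -/
def YPoints.spaceMap {L L' : AlgFrm.{u}} (f : AlgFrm.Hom L L') :
    PGPSP.Hom (YPoints.space L') (YPoints.space L) where
  toFun := YPoints.map f.toFrameHom f.map_compact
  strong := YPoints.isStrongPriestley_map f.toFrameHom f.map_compact
  mapsTo _ hp := infPrime_rightAdjoint f.toFrameHom hp

theorem rightAdjoint_id {L : Type u} [Order.Frame L] (a : L) :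
    rightAdjoint (FrameHom.id L) a = a :=
  eq_of_forall_le_iff fun _ => le_rightAdjoint_frameHom_iff _

theorem rightAdjoint_comp {L₁ L₂ L₃ : Type u} [Order.Frame L₁] [Order.Frame L₂] [Order.Frame L₃]
    (f : FrameHom L₁ L₂) (g : FrameHom L₂ L₃) (a : L₃) :
    rightAdjoint (g.comp f) a = rightAdjoint f (rightAdjoint g a) :=
  eq_of_forall_le_iff fun _ => by
    rw [le_rightAdjoint_frameHom_iff, le_rightAdjoint_frameHom_iff, le_rightAdjoint_frameHom_iff]
    rfl

/-- The functor sending an algebraic frame to its space of pseudoprimes. -/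
def pseudoprimeFunctor : AlgFrm.{u}ᵒᵖ ⥤ PGPSP.{u} where
  obj L := YPoints.space L.unop
  map f := YPoints.spaceMap f.unop
  map_id _ := PGPSP.Hom.ext (funext fun p => Subtype.ext (rightAdjoint_id p.1))
  map_comp f g := PGPSP.Hom.ext (funext fun p => Subtype.ext (rightAdjoint_comp
    (AlgFrm.Hom.toFrameHom g.unop) (AlgFrm.Hom.toFrameHom f.unop) p.1))

/-- The algebraic frame of admissible closed upsets. -/
def PGPSP.closedFrame (X : PGPSP.{u}) : AlgFrm.{u} where
  carrier := X.ClosedUpsets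

/-- The morphism of algebraic frames induced by a morphism of spaces. -/
def PGPSP.comap {X Y : PGPSP.{u}} (f : Hom X Y) : AlgFrm.Hom Y.closedFrame X.closedFrame where
  toFrameHom := ClosedUpsets.comap f.toFun f.strong f.mapsTo
  map_compact _ := ClosedUpsets.isCompactElement_comap f.toFun f.strong f.mapsTo

/-- The functor sending a space to its frame of admissible closed upsets. -/
def admissibleClosedFunctor : PGPSP.{u}ᵒᵖ ⥤ AlgFrm.{u} where
  obj X := X.unop.closedFrame
  map f := PGPSP.comap f.unop
  map_id _ := rfl
  map_comp _ _ := rfl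

/-- An algebraic frame is isomorphic to the admissible closed upsets of its space. -/
noncomputable def AlgFrm.upEquiv (L : AlgFrm.{u}) : L ≃o (YPoints.space L).closedFrame :=
  orderIsoOfLeIff (Q := (YPoints.space L).ClosedUpsets)
    (fun a => PGPSP.ClosedUpsets.mk (YPoints.up a) (YPoints.isAdmissibleClosed_up a))
    (fun _ _ => YPoints.up_subset_up)
    (fun C => by
      obtain ⟨a, ha⟩ := YPoints.exists_eq_up C.prop
      exact ⟨a, PGPSP.ClosedUpsets.ext ha.symm⟩)

/-- A space is order isomorphic to the pseudoprimes of its frame of admissible closed upsets. -/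
noncomputable def PGPSP.pointEquiv (X : PGPSP.{u}) : X ≃o YPoints.space X.closedFrame :=
  orderIsoOfLeIff (Q := YPoints X.ClosedUpsets)
    (fun x => ⟨ClosedUpsets.point x, ClosedUpsets.point_mem_YPoints x⟩)
    (fun _ _ => ClosedUpsets.point_le_point_iff)
    (fun p => by
      obtain ⟨x, hx⟩ := ClosedUpsets.exists_eq_point p.2
      exact ⟨x, Subtype.ext hx.symm⟩)

theorem PGPSP.continuous_pointEquiv (X : PGPSP.{u}) : Continuous X.pointEquiv := by
  have h : ∀ k : X.ClosedUpsets, IsCompactElement k →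
      IsClopen (X.pointEquiv ⁻¹' (YPoints.up k : Set (YPoints X.ClosedUpsets))) := fun k hk => by
    have : X.pointEquiv ⁻¹' (YPoints.up k : Set (YPoints X.ClosedUpsets)) = k.set :=
      Set.ext fun x => ClosedUpsets.le_point_iff
    rw [this]
    exact (ClosedUpsets.isCompactElement_iff.1 hk).1
  have ht : (YPoints.space X.closedFrame).topology = _ := YPoints.topology_eq (L := X.ClosedUpsets)
  rw [ht]
  refine continuous_generateFrom_iff.2 ?_
  rintro _ (⟨k, hk, rfl⟩ | ⟨k, hk, rfl⟩)
  · exact (h k hk).2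
  · exact (h k hk).compl.2

/-- A continuous bijection from a compact space to a Hausdorff space is a homeomorphism. -/
theorem PGPSP.isHomeomorph_pointEquiv (X : PGPSP.{u}) : IsHomeomorph X.pointEquiv :=
  isHomeomorph_iff_continuous_bijective.2 ⟨X.continuous_pointEquiv, X.pointEquiv.bijective⟩

/-- Pseudoprimes and admissible closed upsets give a dual equivalence of categories. -/
noncomputable def pseudoprimeEquivalence : AlgFrm.{u}ᵒᵖ ≌ PGPSP.{u} :=
  CategoryTheory.Equivalence.mk pseudoprimeFunctor admissibleClosedFunctor.rightOp
    (Iso.symm <| NatIso.ofComponents (fun L => (AlgFrm.isoMk L.unop.upEquiv).op) fun f =>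
      Quiver.Hom.unop_inj <| AlgFrm.Hom.ext <| FrameHom.ext fun a => PGPSP.ClosedUpsets.ext <|
        YPoints.preimage_map_up (AlgFrm.Hom.toFrameHom f.unop)
          (AlgFrm.Hom.map_compact f.unop) a)
    (Iso.symm <| NatIso.ofComponents
      (fun X => PGPSP.isoMk X.pointEquiv X.isHomeomorph_pointEquiv
        fun _ => PGPSP.ClosedUpsets.infPrime_point_iff)
      fun f => PGPSP.Hom.ext <| funext fun x => Subtype.ext
        (PGPSP.ClosedUpsets.rightAdjoint_comap_point (PGPSP.Hom.toFun f) (PGPSP.Hom.strong f)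
          (PGPSP.Hom.mapsTo f) x).symm)

theorem isPseudoprimeFunctor_pseudoprimeFunctor : IsPseudoprimeFunctor pseudoprimeFunctor.{u} :=
  ⟨fun _ => OrderIso.refl _, fun _ => ⟨(Homeomorph.refl _).isHomeomorph, Set.image_id _⟩,
    fun _ _ _ _ => rfl⟩

theorem isAdmissibleClosedFunctor_admissibleClosedFunctor :
    IsAdmissibleClosedFunctor admissibleClosedFunctor.{u} :=
  ⟨fun _ => OrderIso.refl _, fun _ _ _ _ => rfl⟩

/-! ### The duality between semilattices and spaces -/

/-- Admissible clopen upsets are the compact elements of the frame of admissible closed upsets. -/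
def PGPSP.clopenEquiv (X : PGPSP.{u}) :
    {U : Set X // IsAdmissibleClopen X.X₀ U} ≃o X.closedFrame.Compacts where
  toFun U := AlgFrm.Compacts.mk (L := X.closedFrame)
    (ClosedUpsets.mk U.1 (isAdmissibleClopen_iff.1 U.2).1)
    (ClosedUpsets.isCompactElement_of_isAdmissibleClopen U.2)
  invFun k := ⟨ClosedUpsets.set k.val, ClosedUpsets.isCompactElement_iff.1 k.isCompact⟩
  left_inv _ := rfl
  right_inv _ := rfl
  map_rel_iff' := Iff.rfl

theorem isAdmissibleClopenFunctor_comp :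
    IsAdmissibleClopenFunctor (admissibleClosedFunctor.{u} ⋙ compactFunctor) :=
  ⟨PGPSP.clopenEquiv, fun _ _ _ _ => rfl⟩

namespace DMSP

variable {M : DMSP.{u}}

theorem isPrimeFilter_iff {F : PFilter M} : IsPrimeFilter F ↔ InfPrime F := by
  refine and_congr ?_ (forall₂_congr fun G H => imp_congr ?_ Iff.rfl)
  · rw [isMax_iff_eq_top, eq_top_iff_coe]
  · exact ⟨fun h x hx => h (mem_inf.1 hx), fun h x hx => h (mem_inf.2 hx)⟩

/-- Prime filters are the primes of the filter frame, which separate its elements. Covers in the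
distributive envelope thus become inequalities between filters. -/
theorem primeSet_subset_iff {b : M} {S : Finset M} :
    primeSet b ⊆ ⋃ a ∈ (S : Set M), primeSet a ↔ S.inf principal ≤ principal b := by
  constructor
  · intro h
    by_contra hle
    obtain ⟨P, hP, hb, hS⟩ := exists_infPrime_of_not_le hle
    obtain ⟨a, ha, haP⟩ := Set.mem_iUnion₂.1
      (h (show (⟨P, isPrimeFilter_iff.2 hP⟩ : {P // IsPrimeFilter P}) ∈ primeSet b from
        principal_le_iff.1 hb))
    exact hS ((Finset.inf_le ha).trans (principal_le_iff.2 haP))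
  · intro h P hb
    obtain ⟨a, ha, haP⟩ := (InfPrime.finset_inf_le (isPrimeFilter_iff.1 P.2)).1
      (h.trans (principal_le_iff.2 hb))
    exact Set.mem_biUnion ha (principal_le_iff.1 haP)

theorem mem_YPoints_iff {F : PFilter M} :
    (IsPseudoprime F ∨ F = ⊤) ↔ ∀ S : Finset M, S.Nonempty → ∀ b ∈ F,
      S.inf principal ≤ principal b → ∃ a ∈ S, a ∈ F := by
  classical
  rw [isPseudoprime_or_eq_top_iff]
  constructor
  · intro h S hS b hb hSb
    obtain ⟨_, ha, haF⟩ := h (S.image principal) (hS.image _)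
      (by simpa using fun a _ => isCompactElement_principal a) (principal b)
      (isCompactElement_principal b) (by rwa [Finset.inf_image]) (principal_le_iff.2 hb)
    obtain ⟨a, haS, rfl⟩ := Finset.mem_image.1 ha
    exact ⟨a, haS, principal_le_iff.1 haF⟩
  · intro h S hS hc k hk hSk hkF
    choose! f hf using fun G hG => Order.PFilter.isCompactElement_iff.1 (hc G hG)
    obtain ⟨b, rfl⟩ := Order.PFilter.isCompactElement_iff.1 hk
    obtain ⟨a, ha, haF⟩ := h (S.image f) (hS.image f) b (principal_le_iff.1 hkF) (by
      refine le_trans ?_ hSk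
      rw [Finset.inf_image]
      exact (Finset.inf_congr rfl fun G hG => (hf G hG).symm).le)
    obtain ⟨G, hG, rfl⟩ := Finset.mem_image.1 ha
    exact ⟨G, hG, (hf G hG).symm ▸ principal_le_iff.2 haF⟩

/-- Pseudoprimality says that no element of `F` is covered by finitely many elements outside `F`.
This holds for traces of prime filters, whose complements are ideals. Conversely, it makes the
filter generated by `F` in the envelope disjoint from the ideal generated by the complement of `F`,
and the prime ideal theorem applies. -/
theorem isOptimalFilter_or_iff {F : PFilter M} :
    (IsOptimalFilter F ∨ (F : Set M) = Set.univ) ↔ (IsPseudoprime F ∨ F = ⊤) := by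
  classical
  constructor
  · rintro (⟨P, hP, hF⟩ | h)
    · have hF' : ∀ x, x ∈ F ↔ toEnvelope x ∈ P := fun x => by
        rw [← SetLike.mem_coe, hF]
        rfl
      refine mem_YPoints_iff.2 fun S hS b hb hSb => ?_
      by_contra! hno
      let U : distributiveEnvelope M :=
        ⟨⋃ a ∈ (S : Set M), primeSet a, S, S.finite_toSet, rfl⟩
      have hU : U = S.sup' hS toEnvelope := by
        refine le_antisymm (Set.iUnion₂_subset fun a ha => ?_)
          (Finset.sup'_le _ _ fun a ha => Set.subset_biUnion_of_mem (u := primeSet) ha)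
        exact Finset.le_sup' toEnvelope ha
      have hUP : U ∈ P := mem_of_le (primeSet_subset_iff.2 hSb) ((hF' b).1 hb)
      have hI := hP.compl_ideal
      have : ∀ a ∈ S, toEnvelope a ∈ hI.toIdeal := fun a ha h => hno a ha ((hF' a).2 h)
      have hUI : U ∈ hI.toIdeal := by
        rw [hU]
        exact Finset.sup'_induction hS _ (fun _ ha _ hb => Order.Ideal.sup_mem ha hb) this
      exact hUI hUP
    · exact Or.inr (eq_top_iff_coe.2 h)
  · intro h
    by_cases htop : F = ⊤
    · exact Or.inr (eq_top_iff_coe.1 htop)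
    left
    have hcov : ∀ (S : Finset M) (b : M), b ∈ F → primeSet b ⊆ ⋃ a ∈ (S : Set M), primeSet a →
        ∃ a ∈ S, a ∈ F := fun S b hb hS => by
      rw [primeSet_subset_iff] at hS
      -- The envelope has a bottom, so the empty cover must be excluded too; this uses `F ≠ ⊤`.
      rcases S.eq_empty_or_nonempty with rfl | hne
      · refine absurd (top_le_iff.1 ?_) htop
        exact (by simpa using hS : (⊤ : PFilter M) ≤ principal b).trans (principal_le_iff.2 hb)
      · exact mem_YPoints_iff.1 h S hne b hb hS
    have hG : Order.IsPFilter {A : distributiveEnvelope M | ∃ b ∈ F, toEnvelope b ≤ A} :=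
      Order.IsPFilter.of_def ⟨toEnvelope ⊤, ⊤, top_mem, le_rfl⟩
        (by
          rintro A ⟨a, ha, haA⟩ B ⟨b, hb, hbB⟩
          refine ⟨toEnvelope (a ⊓ b), ⟨_, inf_mem ha hb, le_rfl⟩, ?_, ?_⟩
          · exact (primeSet_inf a b).ge.trans (Set.inter_subset_left.trans haA)
          · exact (primeSet_inf a b).ge.trans (Set.inter_subset_right.trans hbB))
        (fun hAB ⟨a, ha, haA⟩ => ⟨a, ha, haA.trans hAB⟩)
    have hI : Order.IsIdeal {A : distributiveEnvelope M | ∃ S : Finset M, (∀ a ∈ S, a ∉ F) ∧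
        A.1 ⊆ ⋃ a ∈ (S : Set M), primeSet a} :=
      { IsLowerSet := fun A B hBA ⟨S, hS, hA⟩ => ⟨S, hS, Set.Subset.trans hBA hA⟩
        Nonempty := ⟨⟨∅, ∅, Set.finite_empty, by simp⟩, ∅, by simp, Set.empty_subset _⟩
        Directed := by
          rintro A ⟨S, hS, hA⟩ B ⟨T, hT, hB⟩
          refine ⟨A ⊔ B, ⟨S ∪ T, fun a ha => ?_, ?_⟩, le_sup_left, le_sup_right⟩
          · exact (Finset.mem_union.1 ha).elim (hS a) (hT a)
          · rw [Finset.coe_union, Set.biUnion_union]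
            exact Set.union_subset_union hA hB }
    obtain ⟨J, hJ, hIJ, hdisj⟩ := DistribLattice.prime_ideal_of_disjoint_filter_ideal
      (F := hG.toPFilter) (I := hI.toIdeal) (Set.disjoint_left.2 (by
        rintro A ⟨b, hb, hbA⟩ ⟨S, hS, hA⟩
        obtain ⟨a, ha, haF⟩ := hcov S b hb (Set.Subset.trans hbA hA)
        exact hS a ha haF))
    refine ⟨hJ.toPrimePair.F, hJ.toPrimePair.F_isPrime, Set.ext fun x => ?_⟩
    constructor
    · exact fun hx => Set.disjoint_left.1 hdisj ⟨x, hx, le_rfl⟩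
    · intro hx
      by_contra hxF
      -- The singleton cover places each `x ∉ F` in the ideal, so the trace is no larger than `F`.
      exact hx (hIJ ⟨{x}, by simpa using hxF, by simp [toEnvelope]⟩)

/-- The points of `X_M` are the points of the space of the filter frame. -/
def pointsEquiv (M : DMSP.{u}) : XPoints M ≃o YPoints M.filterFrame where
  toFun F := ⟨F.1, isOptimalFilter_or_iff.1 F.2⟩
  invFun F := ⟨F.1, isOptimalFilter_or_iff.2 F.2⟩
  left_inv _ := rfl
  right_inv _ := rfl
  map_rel_iff' := Iff.rfl

theorem isHomeomorph_pointsEquiv (M : DMSP.{u}) : IsHomeomorph M.pointsEquiv := by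
  have : XPoints.topology M = (YPoints.topology M.filterFrame).induced M.pointsEquiv := by
    rw [YPoints.topology_eq, induced_generateFrom_eq, XPoints.topology, Set.image_union]
    congr 2
    · ext U
      constructor
      · rintro ⟨a, rfl⟩
        exact ⟨_, ⟨principal a, isCompactElement_principal a, rfl⟩,
          Set.ext fun F => principal_le_iff⟩
      · rintro ⟨_, ⟨k, hk, rfl⟩, rfl⟩
        obtain ⟨a, rfl⟩ := Order.PFilter.isCompactElement_iff.1 hk
        exact ⟨a, Set.ext fun F => principal_le_iff⟩
    · ext U
      constructor
      · rintro ⟨a, rfl⟩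
        exact ⟨_, ⟨principal a, isCompactElement_principal a, rfl⟩,
          Set.ext fun F => not_congr principal_le_iff⟩
      · rintro ⟨_, ⟨k, hk, rfl⟩, rfl⟩
        obtain ⟨a, rfl⟩ := Order.PFilter.isCompactElement_iff.1 hk
        exact ⟨a, Set.ext fun F => not_congr principal_le_iff⟩
  exact (M.pointsEquiv.toEquiv.toHomeomorphOfIsInducing ⟨this⟩).isHomeomorph

end DMSP

theorem isOptimalFilterFunctor_comp :
    IsOptimalFilterFunctor (filterFunctor.{u}.op ⋙ pseudoprimeFunctor) := by
  refine ⟨DMSP.pointsEquiv, fun M => ⟨M.isHomeomorph_pointsEquiv, Set.ext fun F => ?_⟩,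
    fun M N α F => ?_⟩
  · constructor
    · rintro ⟨G, hG, rfl⟩
      exact DMSP.isPrimeFilter_iff.1 hG
    · exact fun hF => ⟨M.pointsEquiv.symm F, DMSP.isPrimeFilter_iff.2 hF, rfl⟩
  · have : rightAdjoint (DMSP.mapFilterHom α) F.1 =
        DMSP.comapFilter (DMSP.Hom.toInfTopHom α) F.1 :=
      eq_of_forall_le_iff fun G =>
        (le_rightAdjoint_frameHom_iff _).trans (DMSP.mapFilter_gc _ G F.1)
    exact congrArg (fun G : PFilter M => (G : Set M)) this

/-! ### Characterizations of frame homomorphisms -/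

section Characterization

variable {L₁ L₂ : Type u} [Order.Frame L₁] [Order.Frame L₂]

/-- A join-preserving map that preserves finite meets, as a frame homomorphism. -/
def sSupHom.toFrameHom (α : sSupHom L₁ L₂) (ht : α ⊤ = ⊤) (hi : ∀ a b, α (a ⊓ b) = α a ⊓ α b) :
    FrameHom L₁ L₂ where
  toFun := α
  map_inf' := hi
  map_top' := ht
  map_sSup' := map_sSup α

/-- A failure of meet preservation is witnessed by a prime `p` of `L₂`; the adjunction turns it into
a failure of primality of `rightAdjoint α p`. -/
theorem sSupHom.preserves_finite_inf_of_rightAdjoint [IsCompactlyGenerated L₂]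
    (α : sSupHom L₁ L₂) (h : ∀ p : L₂, InfPrime p → InfPrime (rightAdjoint α p)) :
    α ⊤ = ⊤ ∧ ∀ a b : L₁, α (a ⊓ b) = α a ⊓ α b := by
  have hm : Monotone α := OrderHomClass.mono α
  have hr : ∀ {a b}, a ≤ rightAdjoint α b ↔ α a ≤ b := le_rightAdjoint_iff (map_sSup α) hm
  constructor
  · by_contra ht
    obtain ⟨p, hp, hle, -⟩ := exists_infPrime_of_not_le fun hle => ht (top_le_iff.1 hle)
    exact (h p hp).ne_top (top_le_iff.1 (hr.2 hle))
  · refine fun a b => le_antisymm (hm.map_inf_le a b) ?_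
    by_contra hab
    obtain ⟨p, hp, hle, hnle⟩ := exists_infPrime_of_not_le hab
    exact hnle (((h p hp).2 (hr.2 hle)).elim (fun h' => inf_le_left.trans (hr.1 h'))
      fun h' => inf_le_right.trans (hr.1 h'))

theorem sSupHom.preserves_finite_inf_of_compact [IsCompactlyGenerated L₁] [IsCompactlyGenerated L₂]
    (α : sSupHom L₁ L₂)
    (h : ∀ S : Set L₁, S.Finite → (∀ s ∈ S, IsCompactElement s) →
      ∀ k : L₂, IsCompactElement k → k ≤ sInf (α '' S) →
        ∃ c : L₁, IsCompactElement c ∧ c ≤ sInf S ∧ k ≤ α c) :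
    α ⊤ = ⊤ ∧ ∀ a b : L₁, α (a ⊓ b) = α a ⊓ α b := by
  have hm : Monotone α := OrderHomClass.mono α
  constructor
  · refine top_le_iff.1 (le_iff_compact_le_imp.2 fun k hk _ => ?_)
    obtain ⟨c, -, -, hkc⟩ := h ∅ Set.finite_empty (by simp) k hk (by simp)
    exact hkc.trans (hm le_top)
  · refine fun a b => le_antisymm (hm.map_inf_le a b) (le_iff_compact_le_imp.2 fun k hk hkab => ?_)
    obtain ⟨s, hs, hsa, hks⟩ := exists_compact_le_map (map_sSup α) hm hk (le_inf_iff.1 hkab).1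
    obtain ⟨t, ht, htb, hkt⟩ := exists_compact_le_map (map_sSup α) hm hk (le_inf_iff.1 hkab).2
    obtain ⟨c, -, hc, hkc⟩ := h {s, t} (Set.toFinite _) (by rintro _ (rfl | rfl) <;> assumption)
      k hk (le_sInf (by rintro _ ⟨_, rfl | rfl, rfl⟩ <;> assumption))
    exact hkc.trans (hm (le_inf ((hc.trans (sInf_le (by simp))).trans hsa)
      ((hc.trans (sInf_le (by simp))).trans htb)))

end Characterization

theorem mainTheorem6 :
    (∃ (E : DMSP.{u} ≌ AlgFrm.{u}) (D : AlgFrm.{u}ᵒᵖ ≌ PGPSP.{u}) (D' : DMSP.{u}ᵒᵖ ≌ PGPSP.{u}),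
      IsFilterFunctor E.functor ∧ IsCompactElementsFunctor E.inverse ∧
      IsPseudoprimeFunctor D.functor ∧ IsAdmissibleClosedFunctor D.inverse.leftOp ∧
      IsOptimalFilterFunctor D'.functor ∧ IsAdmissibleClopenFunctor D'.inverse.leftOp ∧
      Nonempty (D'.functor ≅ E.functor.op ⋙ D.functor) ∧
      Nonempty (D'.inverse.leftOp ≅ D.inverse.leftOp ⋙ E.inverse)) ∧
    ∀ (L₁ L₂ : Type u) [Order.Frame L₁] [IsCompactlyGenerated L₁]
      [Order.Frame L₂] [IsCompactlyGenerated L₂] (α : sSupHom L₁ L₂),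
      (∀ k : L₁, IsCompactElement k → IsCompactElement (α k)) →
      List.TFAE [
        α ⊤ = ⊤ ∧ ∀ a b : L₁, α (a ⊓ b) = α a ⊓ α b,
        ∀ p : L₂, InfPrime p → InfPrime (rightAdjoint α p),
        (∃ h : ∀ p : YPoints L₂, IsPseudoprime (rightAdjoint α p.1) ∨ rightAdjoint α p.1 = ⊤,
          IsStrongPriestley (YPoints.primes L₂) (YPoints.primes L₁)
            (fun p => (⟨rightAdjoint α p.1, h p⟩ : YPoints L₁))) ∧
          ∀ p : L₂, InfPrime p → InfPrime (rightAdjoint α p),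
        ∀ S : Set L₁, S.Finite → (∀ s ∈ S, IsCompactElement s) →
          ∀ k : L₂, IsCompactElement k → k ≤ sInf (α '' S) →
            ∃ c : L₁, IsCompactElement c ∧ c ≤ sInf S ∧ k ≤ α c] := by
  refine ⟨⟨filterEquivalence, pseudoprimeEquivalence,
    -- Taking the third duality to be the composite makes both comparison isomorphisms identities.
    filterEquivalence.op.trans pseudoprimeEquivalence,
    isFilterFunctor_filterFunctor, isCompactElementsFunctor_compactFunctor,
    isPseudoprimeFunctor_pseudoprimeFunctor,
    isAdmissibleClosedFunctor_admissibleClosedFunctor,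
    isOptimalFilterFunctor_comp, isAdmissibleClopenFunctor_comp,
    ⟨Iso.refl _⟩, ⟨Iso.refl _⟩⟩, ?_⟩
  intro L₁ L₂ _ _ _ _ α hα
  tfae_have 1 → 3 := fun h =>
    ⟨⟨rightAdjoint_mem_YPoints (α.toFrameHom h.1 h.2) hα,
      YPoints.isStrongPriestley_map (α.toFrameHom h.1 h.2) hα⟩,
      fun _ => infPrime_rightAdjoint (α.toFrameHom h.1 h.2)⟩
  tfae_have 3 → 2 := fun h => h.2
  tfae_have 2 → 1 := α.preserves_finite_inf_of_rightAdjoint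
  tfae_have 1 → 4 := fun h S hS _ k hk hkS => by
    obtain ⟨c, hc, hcS, hkc⟩ := exists_compact_lowerBound (α.toFrameHom h.1 h.2) hS hk
      fun s hs => hkS.trans (sInf_le ⟨s, hs, rfl⟩)
    exact ⟨c, hc, le_sInf hcS, hkc⟩
  tfae_have 4 → 1 := α.preserves_finite_inf_of_compact
  tfae_finish
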